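/- Let $V$ be the non-symmetric operad of sets in which $V(n)$ is the set of complete parenthesizations of a list of $1$'s of length $n$: $V(0)=\emptyset$, $V(1)=\{1\}$, $V(n)=\coprod_{k=1}^{n-1}V(k)\times V(n-k)$ for $n\ge 2$, with composition $\Gamma(1;\alpha)=\alpha$ and $\Gamma((\beta_1,\beta_2);\alpha_1,\dots,\alpha_n)=(\Gamma(\beta_1;\alpha_1,\dots,\alpha_k),\Gamma(\beta_2;\alpha_{k+1},\dots,\alpha_n))$ for $\beta_1\in V(k)$, $\beta_2\in V(n-k)$. Let $LV$ be the free symmetric operad on $V$: $LV(n)=V(n)\times\Sigma_n$, with $\Sigma_n$ acting by right multiplication on the second factor and $$\Gamma((q,\sigma);(r_1,\tau_1),\dots,(r_n,\tau_n))=\bigl(\Gamma(q;r_{\sigma^{-1}1},\dots,r_{\sigma^{-1}n}),\ \sigma\langle k_1,\dots,k_n\rangle\circ(\tau_1\oplus\cdots\oplus\tau_n)\bigr)$$ for $(r_i,\tau_i)\in LV(k_i)$. Let $ELV$ be the categorical operad for which $ELV(n)$ is the category with object set $LV(n)$ and exactly one morphism between any two objects, with the operad structure of $LV$. An algebra over $ELV$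 is a category $\mathcal C$ with functors $ELV(n)\times\mathcal C^n\to\mathcal C$ for $n\ge 0$ that are strictly unital, associative and equivariant; a map of algebras is a functor commuting strictly with these actions. A non-unital symmetric monoidal structure on a category $\mathcal C$ consists of a functor $\otimes:\mathcal C\times\mathcal C\to\mathcal C$ and natural isomorphisms $\alpha:(a\otimes b)\otimes c\cong a\otimes(b\otimes c)$ and $\tau:a\otimes b\cong b\otimes a$ such that the pentagon for $\alpha$ and the hexagon for $\alpha,\tau$ commute and $\tau_{b,a}\circ\tau_{a,b}=1$. A functor between categories with such structures is a strict map if it strictly preserves $\otimes$, $\alpha$ and $\tau$. Theorem. For every category $\mathcal C$, the $ELV$-algebra structures on $\mathcal C$ correspond bijectively to the non-unital symmetric monoidal structures on $\mathcal C$. Under this bijection $\otimes$ is the action of $((1,1),\mathrm{id})\in ELV(2)$, the isomorphism $\alpha$ is the image of the unique morphism $(((1,1),1),\mathrm{id})\to((1,(1,1)),\mathrm{id})$ in $ELV(3)$, and $\tau$ is the image of the unique morphism $((1,1),\mathrm{id})\to((1,1),t)$ in $ELV(2)$, where $t\in\Sigma_2$ is the transposition. A functor between two $ELV$-algebras is a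 map of algebras if and only if it is a strict map of the corresponding non-unital symmetric monoidal categories, and the bijection extends to an isomorphism, over the category of categories, between the category of $ELV$-algebras and the category of non-unital symmetric monoidal categories and strict maps. -/

import Mathlib

open CategoryTheory

universe v u v₁ u₁ w

namespace SymMonOperads

/-! ### Blocks: splitting `{0, …, m-1}` into consecutive blocks of lengths `k 0, k 1, …` -/

/-- If `m = k 0 + ⋯ + k (n-1)`, the `j`-th element of the `i`-th block is the element
`k 0 + ⋯ + k (i-1) + j` of `Fin m`. -/
def blockEquiv {n m : ℕ} (k : Fin n → ℕ) (h : ∑ i, k i = m) : (Σ i, Fin (k i)) ≃ Fin m :=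
  finSigmaFinEquiv.trans (finCongr h)

theorem sum_perm {n m : ℕ} (σ : Equiv.Perm (Fin n)) {k : Fin n → ℕ} (h : ∑ i, k i = m) :
    ∑ i, k (σ⁻¹ i) = m := by
  rw [← h]; exact Equiv.sum_comp σ⁻¹ k

/-- The block permutation `σ⟨k 0, …, k (n-1)⟩` of `Fin m`: it carries the `i`-th block (of
length `k i`) of the source to the `σ i`-th block of the target, preserving the order inside each
block.  The lengths of the blocks of the target are `k (σ⁻¹ 0), …, k (σ⁻¹ (n-1))`. -/
def blockPerm {n m : ℕ} (σ : Equiv.Perm (Fin n)) (k : Fin n → ℕ) (h : ∑ i, k i = m) :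
    Equiv.Perm (Fin m) :=
  (blockEquiv k h).symm.trans
    ((Equiv.sigmaCongrLeft (β := fun i => Fin (k i)) σ⁻¹).symm.trans
      (blockEquiv (fun i => k (σ⁻¹ i)) (sum_perm σ h)))

/-- The block sum `τ 0 ⊕ ⋯ ⊕ τ (n-1)`: it permutes the `i`-th block by `τ i`. -/
def blockSum {n m : ℕ} (k : Fin n → ℕ) (h : ∑ i, k i = m) (τ : ∀ i, Equiv.Perm (Fin (k i))) :
    Equiv.Perm (Fin m) :=
  (blockEquiv k h).symm.trans ((Equiv.sigmaCongrRight τ).trans (blockEquiv k h))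

/-! ### Operads -/

/-- A non-symmetric operad of sets.  The composite `Γ(x; y 0, …, y (n-1))` is `comp k h x y`, where
`k i` is the degree of `y i` and `m = k 0 + ⋯ + k (n-1)` is the degree of the composite. -/
structure NSOperad where
  obj : ℕ → Type w
  one : obj 1
  comp {n m : ℕ} (k : Fin n → ℕ) (h : ∑ i, k i = m) (x : obj n) (y : ∀ i, obj (k i)) : obj m
  one_comp {n : ℕ} (h : ∑ _i : Fin 1, n = n) (x : obj n) :
    comp (fun _ => n) h one (fun _ => x) = x
  comp_one {n : ℕ} (h : ∑ _i : Fin n, 1 = n) (x : obj n) :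
    comp (fun _ => 1) h x (fun _ => one) = x
  assoc {n m N : ℕ} (k : Fin n → ℕ) (hk : ∑ i, k i = m)
    (l : ∀ i, Fin (k i) → ℕ) (p : Fin n → ℕ) (hl : ∀ i, ∑ j, l i j = p i)
    (h : ∑ s, l ((blockEquiv k hk).symm s).1 ((blockEquiv k hk).symm s).2 = N)
    (h' : ∑ i, p i = N) (x : obj n) (y : ∀ i, obj (k i)) (z : ∀ i j, obj (l i j)) :
    comp (fun s => l ((blockEquiv k hk).symm s).1 ((blockEquiv k hk).symm s).2) h
        (comp k hk x y) (fun s => z ((blockEquiv k hk).symm s).1 ((blockEquiv k hk).symm s).2) =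
      comp p h' x (fun i => comp (l i) (hl i) (y i) (z i))

/-- A (symmetric) operad of sets: `act σ x` is the right action `x · σ`. -/
structure SymmOperad extends NSOperad.{w} where
  act {n : ℕ} (σ : Equiv.Perm (Fin n)) (x : obj n) : obj n
  act_one {n : ℕ} (x : obj n) : act 1 x = x
  act_mul {n : ℕ} (σ τ : Equiv.Perm (Fin n)) (x : obj n) : act (σ * τ) x = act τ (act σ x)
  comp_act_left {n m : ℕ} (σ : Equiv.Perm (Fin n)) (k : Fin n → ℕ) (h : ∑ i, k i = m)
    (x : obj n) (y : ∀ i, obj (k i)) :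
    comp k h (act σ x) y =
      act (blockPerm σ k h) (comp (fun i => k (σ⁻¹ i)) (sum_perm σ h) x (fun i => y (σ⁻¹ i)))
  comp_act_right {n m : ℕ} (k : Fin n → ℕ) (h : ∑ i, k i = m)
    (τ : ∀ i, Equiv.Perm (Fin (k i))) (x : obj n) (y : ∀ i, obj (k i)) :
    comp k h x (fun i => act (τ i) (y i)) = act (blockSum k h τ) (comp k h x y)

section Tuples

/-- The canonical functor `(∏ A i) × (∏ B i) ⥤ ∏ (A i × B i)`. -/
def zipFunctor {n : ℕ} (A : Fin n → Type u) (B : Fin n → Type u₁) [∀ i, Category.{v} (A i)]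
    [∀ i, Category.{v₁} (B i)] : (∀ i, A i) × (∀ i, B i) ⥤ ∀ i, A i × B i :=
  Functor.pi' (fun i => (Pi.eval A i).prod (Pi.eval B i))

/-- The canonical functor `∏ i, ∏ j, A (l i j) ⥤ ∏ s, A (l' s)` that lists a doubly indexed family
block after block. -/
def joinFunctor (A : ℕ → Type u) [∀ n, Category.{v} (A n)] {n m : ℕ} (k : Fin n → ℕ)
    (hk : ∑ i, k i = m) (l : ∀ i, Fin (k i) → ℕ) :
    (∀ i j, A (l i j)) ⥤
      (∀ s, A (l ((blockEquiv k hk).symm s).1 ((blockEquiv k hk).symm s).2)) :=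
  Functor.pi' (fun s =>
    Pi.eval (fun i => ∀ j, A (l i j)) ((blockEquiv k hk).symm s).1 ⋙
      Pi.eval (fun j => A (l ((blockEquiv k hk).symm s).1 j)) ((blockEquiv k hk).symm s).2)

/-- The canonical functor `C ^ m ⥤ ∏ i, C ^ (k i)` that cuts a list into blocks. -/
def splitFunctor (C : Type u) [Category.{v} C] {n m : ℕ} (k : Fin n → ℕ) (h : ∑ i, k i = m) :
    (Fin m → C) ⥤ (∀ i, Fin (k i) → C) :=
  Functor.pi' (fun i => Pi.comap (fun _ : Fin m => C) (fun j => blockEquiv k h ⟨i, j⟩))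

/-- The left action of `σ` on lists, `(c 0, …, c (n-1)) ↦ (c (σ⁻¹ 0), …, c (σ⁻¹ (n-1)))`. -/
def permFunctor (C : Type u) [Category.{v} C] {n : ℕ} (σ : Equiv.Perm (Fin n)) :
    (Fin n → C) ⥤ (Fin n → C) :=
  Pi.comap (fun _ : Fin n => C) (fun i => σ⁻¹ i)

end Tuples

/-- A categorical operad: a symmetric operad in the cartesian monoidal category of categories. -/
structure CatOperad where
  obj : ℕ → Type u
  [cat : ∀ n, Category.{v} (obj n)]
  one : obj 1
  comp {n m : ℕ} (k : Fin n → ℕ) (h : ∑ i, k i = m) : obj n × (∀ i, obj (k i)) ⥤ obj m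
  act {n : ℕ} (σ : Equiv.Perm (Fin n)) : obj n ⥤ obj n
  one_comp {n : ℕ} (h : ∑ _i : Fin 1, n = n) :
    Functor.pi' (fun _ : Fin 1 => 𝟭 (obj n)) ⋙ Prod.sectR one (Fin 1 → obj n) ⋙
      comp (fun _ => n) h = 𝟭 (obj n)
  comp_one {n : ℕ} (h : ∑ _i : Fin n, 1 = n) :
    Prod.sectL (obj n) (fun _ : Fin n => one) ⋙ comp (fun _ => 1) h = 𝟭 (obj n)
  assoc {n m N : ℕ} (k : Fin n → ℕ) (hk : ∑ i, k i = m)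
    (l : ∀ i, Fin (k i) → ℕ) (p : Fin n → ℕ) (hl : ∀ i, ∑ j, l i j = p i)
    (h : ∑ s, l ((blockEquiv k hk).symm s).1 ((blockEquiv k hk).symm s).2 = N)
    (h' : ∑ i, p i = N) :
    prod.inverseAssociator (obj n) (∀ i, obj (k i)) (∀ i j, obj (l i j)) ⋙
        (comp k hk).prod (joinFunctor obj k hk l) ⋙ comp _ h =
      (𝟭 (obj n)).prod
          (zipFunctor (fun i => obj (k i)) (fun i => ∀ j, obj (l i j)) ⋙
            Functor.pi (fun i => comp (l i) (hl i))) ⋙ comp p h'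
  act_one {n : ℕ} : act (1 : Equiv.Perm (Fin n)) = 𝟭 (obj n)
  act_mul {n : ℕ} (σ τ : Equiv.Perm (Fin n)) : act (σ * τ) = act σ ⋙ act τ
  comp_act_left {n m : ℕ} (σ : Equiv.Perm (Fin n)) (k : Fin n → ℕ) (h : ∑ i, k i = m) :
    (act σ).prod (𝟭 (∀ i, obj (k i))) ⋙ comp k h =
      (𝟭 (obj n)).prod (Pi.comap (fun i => obj (k i)) (fun i => σ⁻¹ i)) ⋙
        comp (fun i => k (σ⁻¹ i)) (sum_perm σ h) ⋙ act (blockPerm σ k h)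
  comp_act_right {n m : ℕ} (k : Fin n → ℕ) (h : ∑ i, k i = m)
    (τ : ∀ i, Equiv.Perm (Fin (k i))) :
    (𝟭 (obj n)).prod (Functor.pi (fun i => act (τ i))) ⋙ comp k h =
      comp k h ⋙ act (blockSum k h τ)

attribute [instance] CatOperad.cat

/-! ### The operad `V` of parenthesizations -/

/-- Complete parenthesizations of nonempty lists of `1`'s. -/
inductive Paren : Type
  | one : Paren
  | pair : Paren → Paren → Paren

namespace Paren

/-- The length of the parenthesized list. -/
def deg : Paren → ℕ
  | one => 1
  | pair s t => s.deg + t.deg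

/-- Replace the successive `1`'s of `t` by the parenthesizations `a 0, a 1, …`. -/
def graft : (t : Paren) → (Fin t.deg → Paren) → Paren
  | one, a => a ⟨0, Nat.one_pos⟩
  | pair s t, a =>
      pair (s.graft fun i => a (Fin.castAdd t.deg i)) (t.graft fun i => a (Fin.natAdd s.deg i))

end Paren

/-- `V n` is the set of complete parenthesizations of a list of length `n`; thus `V 0 = ∅`,
`V 1 = {1}`, and for `n ≥ 2` an element of `V n` is a pair of elements of `V k` and `V (n - k)` for
a unique `k` with `1 ≤ k ≤ n - 1`. -/
def V (n : ℕ) : Type := {t : Paren // t.deg = n}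

/-! ### Auxiliary facts on blocks and on grafting -/

section Aux

theorem blockEquiv_val {n m : ℕ} (k : Fin n → ℕ) (h : ∑ i, k i = m) (K : ℕ → ℕ)
    (hK : ∀ i : Fin n, K i = k i) (i : Fin n) (j : Fin (k i)) :
    (blockEquiv k h ⟨i, j⟩ : ℕ) = ∑ x ∈ Finset.range i, K x + j := by
  have h1 : (blockEquiv k h ⟨i, j⟩ : ℕ) = (finSigmaFinEquiv ⟨i, j⟩ : Fin _) := rfl
  rw [h1, finSigmaFinEquiv_apply, ← Fin.sum_univ_eq_sum_range K]
  congr 1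
  exact Finset.sum_congr rfl fun x _ => (hK _).symm

theorem exists_ext {α : Type*} (d : α) {n : ℕ} (k : Fin n → α) :
    ∃ K : ℕ → α, ∀ i : Fin n, K i = k i :=
  ⟨fun i => if h : i < n then k ⟨i, h⟩ else d, fun i => by simp⟩

/-- Blocks of blocks: listing a triply indexed family in either of the two ways. -/
theorem blockEquiv_assoc {n m N : ℕ} (k : Fin n → ℕ) (hk : ∑ i, k i = m)
    (l : ∀ i, Fin (k i) → ℕ) (p : Fin n → ℕ) (hl : ∀ i, ∑ j, l i j = p i)
    (L : Fin m → ℕ) (hL : ∀ i j, L (blockEquiv k hk ⟨i, j⟩) = l i j)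
    (h : ∑ s, L s = N) (h' : ∑ i, p i = N) (i : Fin n) (j : Fin (k i)) (q : Fin (l i j)) :
    blockEquiv L h ⟨blockEquiv k hk ⟨i, j⟩, Fin.cast (hL i j).symm q⟩ =
      blockEquiv p h' ⟨i, blockEquiv (l i) (hl i) ⟨j, q⟩⟩ := by
  obtain ⟨K, hK⟩ := exists_ext 0 k
  obtain ⟨L', hL'⟩ := exists_ext 0 L
  obtain ⟨P, hP⟩ := exists_ext 0 p
  apply Fin.ext
  have key : ∀ (i : Fin n) (b : ℕ), b ≤ k i → ∀ M : ℕ → ℕ, (∀ j : Fin (k i), M j = l i j) →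
      ∑ x ∈ Finset.range b, L' (∑ y ∈ Finset.range i, K y + x) = ∑ x ∈ Finset.range b, M x := by
    intro i b hb M hM
    refine Finset.sum_congr rfl fun x hx => ?_
    have hx' : x < k i := lt_of_lt_of_le (Finset.mem_range.1 hx) hb
    have := blockEquiv_val k hk K hK i ⟨x, hx'⟩
    rw [show M x = l i ⟨x, hx'⟩ from hM ⟨x, hx'⟩, ← hL i ⟨x, hx'⟩, ← hL', this]
  have key2 : ∀ a : ℕ, a ≤ n →
      ∑ x ∈ Finset.range (∑ y ∈ Finset.range a, K y), L' x = ∑ x ∈ Finset.range a, P x := by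
    intro a
    induction a with
    | zero => simp
    | succ a ih =>
      intro ha
      rw [Finset.sum_range_succ, Finset.sum_range_add, ih (by omega), Finset.sum_range_succ]
      congr 1
      obtain ⟨M, hM⟩ := exists_ext 0 (l ⟨a, ha⟩)
      rw [hK ⟨a, ha⟩, key ⟨a, ha⟩ _ le_rfl M hM, hP ⟨a, ha⟩, ← hl, ← Fin.sum_univ_eq_sum_range M]
      exact Finset.sum_congr rfl fun x _ => hM x
  obtain ⟨M, hM⟩ := exists_ext 0 (l i)
  rw [blockEquiv_val L h L' hL', blockEquiv_val p h' P hP, blockEquiv_val (l i) (hl i) M hM,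
    blockEquiv_val k hk K hK, Finset.sum_range_add, key2 i i.2.le, key i j j.2.le M hM, Fin.val_cast,
    add_assoc]

theorem blockEquiv_congr {n m : ℕ} {k k' : Fin n → ℕ} (hk : k = k') (h : ∑ i, k i = m)
    (h' : ∑ i, k' i = m) {i i' : Fin n} (hi : i = i') (j : Fin (k i)) (j' : Fin (k' i'))
    (hj : (j : ℕ) = j') : blockEquiv k h ⟨i, j⟩ = blockEquiv k' h' ⟨i', j'⟩ := by
  subst hk hi
  obtain rfl := Fin.ext hj
  rfl

theorem blockPerm_inv_apply {n m : ℕ} (σ : Equiv.Perm (Fin n)) (k : Fin n → ℕ)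
    (h : ∑ i, k i = m) (i : Fin n) (j : Fin (k (σ⁻¹ i))) :
    (blockPerm σ k h)⁻¹ (blockEquiv (fun i => k (σ⁻¹ i)) (sum_perm σ h) ⟨i, j⟩) =
      blockEquiv k h ⟨σ⁻¹ i, j⟩ := by
  change (blockPerm σ k h).symm _ = _
  simp [blockPerm, Equiv.sigmaCongrLeft]

theorem blockSum_inv_apply {n m : ℕ} (k : Fin n → ℕ) (h : ∑ i, k i = m)
    (τ : ∀ i, Equiv.Perm (Fin (k i))) (i : Fin n) (j : Fin (k i)) :
    (blockSum k h τ)⁻¹ (blockEquiv k h ⟨i, j⟩) = blockEquiv k h ⟨i, (τ i)⁻¹ j⟩ := by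
  change (blockSum k h τ).symm _ = _
  simp [blockSum, Equiv.sigmaCongrRight]

/-- Two permutations agree if their inverses agree on all blocks. -/
theorem perm_ext_blocks {n m : ℕ} (k : Fin n → ℕ) (h : ∑ i, k i = m) {ρ ρ' : Equiv.Perm (Fin m)}
    (H : ∀ i j, ρ⁻¹ (blockEquiv k h ⟨i, j⟩) = ρ'⁻¹ (blockEquiv k h ⟨i, j⟩)) : ρ = ρ' := by
  apply inv_injective
  ext1 s
  obtain ⟨⟨i, j⟩, rfl⟩ := (blockEquiv k h).surjective s
  exact H i j

theorem perm_inv_apply {n m : ℕ} (σ : Equiv.Perm (Fin n)) (k : Fin n → ℕ) (h : ∑ i, k i = m)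
    (τ : ∀ i, Equiv.Perm (Fin (k i))) (i : Fin n) (j : Fin (k (σ⁻¹ i))) :
    (blockPerm σ k h * blockSum k h τ)⁻¹ (blockEquiv (fun i => k (σ⁻¹ i)) (sum_perm σ h) ⟨i, j⟩) =
      blockEquiv k h ⟨σ⁻¹ i, (τ (σ⁻¹ i))⁻¹ j⟩ := by
  rw [mul_inv_rev, Equiv.Perm.mul_apply, blockPerm_inv_apply, blockSum_inv_apply]

theorem perm_one_comp {n : ℕ} (h : ∑ _i : Fin 1, n = n) (τ : Equiv.Perm (Fin n)) :
    blockPerm 1 (fun _ : Fin 1 => n) h * blockSum (fun _ : Fin 1 => n) h (fun _ => τ) = τ := by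
  have hid : ∀ (i : Fin 1) (j : Fin n), blockEquiv (fun _ : Fin 1 => n) h ⟨i, j⟩ = j := by
    intro i j
    apply Fin.ext
    rw [blockEquiv_val _ h (fun _ => n) fun _ => rfl]
    simp
  refine perm_ext_blocks (fun _ => n) h fun i j => ?_
  rw [perm_inv_apply 1 (fun _ : Fin 1 => n) h (fun _ => τ) i j, hid, hid]

theorem perm_comp_one {n : ℕ} (h : ∑ _i : Fin n, 1 = n) (σ : Equiv.Perm (Fin n)) :
    blockPerm σ (fun _ : Fin n => 1) h * blockSum (fun _ : Fin n => 1) h (fun _ => 1) = σ := by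
  have hid : ∀ (i : Fin n) (j : Fin 1), blockEquiv (fun _ : Fin n => 1) h ⟨i, j⟩ = i := by
    intro i j
    apply Fin.ext
    rw [blockEquiv_val _ h (fun _ => 1) fun _ => rfl]
    simp
  refine perm_ext_blocks (fun _ => 1) h fun i j => ?_
  rw [perm_inv_apply σ (fun _ : Fin n => 1) h (fun _ => 1) i j, hid, hid]

theorem perm_comp_mul {n m : ℕ} (ρ σ : Equiv.Perm (Fin n)) (k : Fin n → ℕ) (h : ∑ i, k i = m)
    (τ : ∀ i, Equiv.Perm (Fin (k i))) :
    blockPerm (ρ * σ) k h * blockSum k h τ =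
      blockPerm ρ (fun i => k (σ⁻¹ i)) (sum_perm σ h) *
        blockSum (fun i => k (σ⁻¹ i)) (sum_perm σ h) (fun i => τ (σ⁻¹ i)) * blockPerm σ k h := by
  refine perm_ext_blocks (fun i => k ((ρ * σ)⁻¹ i)) (sum_perm (ρ * σ) h) fun i j => ?_
  rw [perm_inv_apply, mul_inv_rev (_ * _) (blockPerm σ k h), Equiv.Perm.mul_apply]
  have := perm_inv_apply ρ (fun i => k (σ⁻¹ i)) (sum_perm σ h) (fun i => τ (σ⁻¹ i)) i j
  refine Eq.trans ?_ (congrArg (fun t => (blockPerm σ k h)⁻¹ t) this.symm)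
  rw [blockPerm_inv_apply]
  rfl

theorem perm_comp_sum {n m : ℕ} (σ : Equiv.Perm (Fin n)) (k : Fin n → ℕ) (h : ∑ i, k i = m)
    (τ τ' : ∀ i, Equiv.Perm (Fin (k i))) :
    blockPerm σ k h * blockSum k h (fun i => τ i * τ' i) =
      blockPerm σ k h * blockSum k h τ * blockSum k h τ' := by
  refine perm_ext_blocks (fun i => k (σ⁻¹ i)) (sum_perm σ h) fun i j => ?_
  rw [perm_inv_apply, mul_inv_rev (_ * _), Equiv.Perm.mul_apply, perm_inv_apply,
    blockSum_inv_apply]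
  simp only [mul_inv_rev, Equiv.Perm.mul_apply]

theorem perm_assoc {n m N : ℕ} (σ : Equiv.Perm (Fin n)) (k : Fin n → ℕ) (hk : ∑ i, k i = m)
    (τ : ∀ i, Equiv.Perm (Fin (k i))) (l : ∀ i, Fin (k i) → ℕ) (p : Fin n → ℕ)
    (hl : ∀ i, ∑ j, l i j = p i)
    (h : ∑ s, l ((blockEquiv k hk).symm s).1 ((blockEquiv k hk).symm s).2 = N)
    (h' : ∑ i, p i = N) (ρ : ∀ i j, Equiv.Perm (Fin (l i j))) :
    blockPerm (blockPerm σ k hk * blockSum k hk τ)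
          (fun s => l ((blockEquiv k hk).symm s).1 ((blockEquiv k hk).symm s).2) h *
        blockSum (fun s => l ((blockEquiv k hk).symm s).1 ((blockEquiv k hk).symm s).2) h
          (fun s => ρ ((blockEquiv k hk).symm s).1 ((blockEquiv k hk).symm s).2) =
      blockPerm σ p h' *
        blockSum p h' (fun i => blockPerm (τ i) (l i) (hl i) * blockSum (l i) (hl i) (ρ i)) := by
  have X : ∀ (s : Fin m) (t : Σ i, Fin (k i)) (ht : t = (blockEquiv k hk).symm s)
      (q : Fin (l t.1 t.2))
      (q' : Fin (l ((blockEquiv k hk).symm s).1 ((blockEquiv k hk).symm s).2)), (q' : ℕ) = q →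
      blockEquiv (fun s => l ((blockEquiv k hk).symm s).1 ((blockEquiv k hk).symm s).2) h
        ⟨s, (ρ ((blockEquiv k hk).symm s).1 ((blockEquiv k hk).symm s).2)⁻¹ q'⟩ =
      blockEquiv p h' ⟨t.1, blockEquiv (l t.1) (hl t.1) ⟨t.2, (ρ t.1 t.2)⁻¹ q⟩⟩ := by
    intro s t ht q q' hq
    subst ht
    obtain rfl := Fin.ext hq
    rw [← blockEquiv_assoc k hk l p hl _ (fun i j => by rw [Equiv.symm_apply_apply]) h h']
    exact blockEquiv_congr rfl _ _ ((blockEquiv k hk).apply_symm_apply s).symm _ _ rfl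
  refine perm_ext_blocks (fun s => l
    ((blockEquiv k hk).symm ((blockPerm σ k hk * blockSum k hk τ)⁻¹ s)).1
    ((blockEquiv k hk).symm ((blockPerm σ k hk * blockSum k hk τ)⁻¹ s)).2)
    (sum_perm (blockPerm σ k hk * blockSum k hk τ) h) fun s q => ?_
  obtain ⟨⟨i, j⟩, rfl⟩ := (blockEquiv (fun i => k (σ⁻¹ i)) (sum_perm σ hk)).surjective s
  have hL : ∀ (i : Fin n) (j : Fin (k (σ⁻¹ i))),
      (⟨σ⁻¹ i, (τ (σ⁻¹ i))⁻¹ j⟩ : Σ i, Fin (k i)) =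
      (blockEquiv k hk).symm ((blockPerm σ k hk * blockSum k hk τ)⁻¹
        (blockEquiv (fun i => k (σ⁻¹ i)) (sum_perm σ hk) ⟨i, j⟩)) := by
    intro i j
    rw [perm_inv_apply, Equiv.symm_apply_apply]
  have hL' := fun i j => congrArg (fun t : Σ i, Fin (k i) => l t.1 t.2) (hL i j)
  refine (perm_inv_apply (blockPerm σ k hk * blockSum k hk τ) _ h _ _ q).trans ?_
  refine (X _ _ (hL i j) (Fin.cast (hL' i j).symm q) q rfl).trans ?_
  have A := blockEquiv_assoc (fun i => k (σ⁻¹ i)) (sum_perm σ hk)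
    (fun i j => l (σ⁻¹ i) ((τ (σ⁻¹ i))⁻¹ j)) (fun i => p (σ⁻¹ i))
    (fun i => sum_perm _ (hl _)) _ (fun i j => (hL' i j).symm)
    (sum_perm (blockPerm σ k hk * blockSum k hk τ) h) (sum_perm σ h') i j
    (Fin.cast (hL' i j).symm q)
  refine Eq.trans ?_ (congrArg (fun t => (blockPerm σ p h' * blockSum p h'
    (fun i => blockPerm (τ i) (l i) (hl i) * blockSum (l i) (hl i) (ρ i)))⁻¹ t) A.symm)
  refine Eq.trans ?_ (perm_inv_apply σ p h' _ i _).symm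
  exact congrArg (fun t => blockEquiv p h' ⟨σ⁻¹ i, t⟩)
    (perm_inv_apply (τ (σ⁻¹ i)) (l (σ⁻¹ i)) (hl _) (ρ (σ⁻¹ i)) j _).symm

namespace Paren

/-- Grafting of an infinite sequence, of which only the first `deg t` terms are used. -/
def graftSeq : Paren → (ℕ → Paren) → Paren
  | one, a => a 0
  | pair s t, a => pair (s.graftSeq a) (t.graftSeq fun i => a (s.deg + i))

theorem graft_eq (t : Paren) (a : Fin t.deg → Paren) (A : ℕ → Paren) (h : ∀ i : Fin t.deg, A i = a i) :
    t.graft a = t.graftSeq A := by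
  induction t generalizing A with
  | one => exact (h _).symm
  | pair s t ihs iht =>
    simp only [graft, graftSeq]
    rw [ihs _ A fun i => h (Fin.castAdd _ i),
      iht _ (fun i => A (s.deg + i)) fun i => h (Fin.natAdd _ i)]

theorem deg_graftSeq (t : Paren) (A : ℕ → Paren) :
    (t.graftSeq A).deg = ∑ i ∈ Finset.range t.deg, (A i).deg := by
  induction t generalizing A with
  | one => simp [graftSeq, deg]
  | pair s t ihs iht => simp only [graftSeq, deg, Finset.sum_range_add, ihs, iht]

theorem deg_graft (t : Paren) (a : Fin t.deg → Paren) : (t.graft a).deg = ∑ i, (a i).deg := by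
  obtain ⟨A, hA⟩ := exists_ext one a
  rw [graft_eq t a A hA, deg_graftSeq, ← Fin.sum_univ_eq_sum_range fun i => (A i).deg]
  simp only [hA]

theorem graftSeq_congr (t : Paren) (A B : ℕ → Paren) (h : ∀ i < t.deg, A i = B i) :
    t.graftSeq A = t.graftSeq B := by
  rw [← graft_eq t (fun i => A i) A fun _ => rfl, graft_eq t (fun i => A i) B fun i => (h i i.2).symm]

theorem graftSeq_one (t : Paren) : t.graftSeq (fun _ => one) = t := by
  induction t with
  | one => rfl
  | pair s t ihs iht => simp only [graftSeq, ihs, iht]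

theorem graftSeq_graftSeq (t : Paren) (A B : ℕ → Paren) :
    (t.graftSeq A).graftSeq B =
      t.graftSeq fun i => (A i).graftSeq fun j => B (∑ x ∈ Finset.range i, (A x).deg + j) := by
  induction t generalizing A B with
  | one => simp [graftSeq]
  | pair s t ihs iht =>
    simp only [graftSeq, ihs, iht, deg_graftSeq, Finset.sum_range_add, add_assoc]

end Paren

end Aux

/-- Composition in `V`: `Γ(1; α) = α` and
`Γ((β₁, β₂); α 0, …, α (n-1)) = (Γ(β₁; α 0, …, α (k-1)), Γ(β₂; α k, …, α (n-1)))`. -/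
def V.comp {n m : ℕ} (k : Fin n → ℕ) (h : ∑ i, k i = m) (β : V n) (α : ∀ i, V (k i)) : V m :=
  ⟨β.1.graft fun i => (α (Fin.cast β.2 i)).1, by
    rw [Paren.deg_graft]
    obtain ⟨β, rfl⟩ := β
    rw [← h]
    exact Finset.sum_congr rfl fun i _ => (α i).2⟩

theorem V.comp_val {n m : ℕ} (k : Fin n → ℕ) (h : ∑ i, k i = m) (β : V n) (α : ∀ i, V (k i))
    (A : ℕ → Paren) (hA : ∀ i : Fin n, A i = (α i).1) : (V.comp k h β α).1 = β.1.graftSeq A :=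
  Paren.graft_eq _ _ _ fun i => hA (Fin.cast β.2 i)

/-- The magma operad: the non-symmetric operad of sets `V`. -/
def operadV : NSOperad.{0} where
  obj := V
  one := ⟨Paren.one, rfl⟩
  comp := V.comp
  one_comp h x := rfl
  comp_one h x := by
    apply Subtype.ext
    exact (V.comp_val _ h x _ (fun _ => Paren.one) fun _ => rfl).trans (Paren.graftSeq_one _)
  assoc {n m N} k hk l p hl h h' x y z := by
    apply Subtype.ext
    obtain ⟨A, hA⟩ := exists_ext Paren.one fun i => (y i).1
    obtain ⟨B, hB⟩ := exists_ext Paren.one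
      fun s => (z ((blockEquiv k hk).symm s).1 ((blockEquiv k hk).symm s).2).1
    rw [V.comp_val _ h _ _ B hB, V.comp_val k hk x y A hA, Paren.graftSeq_graftSeq]
    symm
    obtain ⟨C, hC⟩ := exists_ext Paren.one fun i => (V.comp (l i) (hl i) (y i) (z i)).1
    rw [V.comp_val p h' x _ C hC]
    apply Paren.graftSeq_congr
    intro i hi
    rw [x.2] at hi
    rw [hC ⟨i, hi⟩]
    obtain ⟨D, hD⟩ := exists_ext Paren.one fun j => (z ⟨i, hi⟩ j).1
    rw [V.comp_val _ _ _ _ D hD, hA ⟨i, hi⟩]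
    apply Paren.graftSeq_congr
    intro j hj
    rw [(y ⟨i, hi⟩).2] at hj
    rw [hD ⟨j, hj⟩]
    have hv := blockEquiv_val k hk (fun x => (A x).deg)
      (fun i => by rw [hA i]; exact (y i).2) ⟨i, hi⟩ ⟨j, hj⟩
    have := hB (blockEquiv k hk ⟨⟨i, hi⟩, ⟨j, hj⟩⟩)
    rw [hv] at this
    rw [this, Equiv.symm_apply_apply]

/-! ### The free symmetric operad `L Q` on a non-symmetric operad `Q` -/

namespace NSOperad

theorem comp_congr (Q : NSOperad.{w}) {n m : ℕ} {k k' : Fin n → ℕ} (h : ∑ i, k i = m)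
    (h' : ∑ i, k' i = m) (x : Q.obj n) (y : ∀ i, Q.obj (k i)) (y' : ∀ i, Q.obj (k' i))
    (H : ∀ i, (⟨k i, y i⟩ : Σ a, Q.obj a) = ⟨k' i, y' i⟩) : Q.comp k h x y = Q.comp k' h' x y' := by
  have hk : k = k' := funext fun i => congrArg Sigma.fst (H i)
  subst hk
  have hy : y = y' := funext fun i => eq_of_heq (Sigma.mk.inj (H i)).2
  rw [hy]

/-- `L Q (n) = Q (n) × Σ_n` with the regular right action of `Σ_n`, and
`Γ((q, σ); (r i, τ i)) = (Γ(q; r (σ⁻¹ 0), …, r (σ⁻¹ (n-1))), σ⟨k 0, …⟩ ∘ (τ 0 ⊕ ⋯ ⊕ τ (n-1)))`. -/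
def L (Q : NSOperad.{w}) : SymmOperad.{w} where
  obj n := Q.obj n × Equiv.Perm (Fin n)
  one := (Q.one, 1)
  comp {n m} k h x y :=
    (Q.comp (fun i => k (x.2⁻¹ i)) (sum_perm x.2 h) x.1 (fun i => (y (x.2⁻¹ i)).1),
      blockPerm x.2 k h * blockSum k h (fun i => (y i).2))
  act σ x := (x.1, x.2 * σ)
  one_comp h x := Prod.ext (Q.one_comp h x.1) (perm_one_comp h x.2)
  comp_one h x := Prod.ext (Q.comp_one h x.1) (perm_comp_one h x.2)
  act_one _ := rfl
  act_mul σ τ x := Prod.ext rfl (mul_assoc x.2 σ τ).symm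
  comp_act_left σ k h x y := Prod.ext rfl (perm_comp_mul x.2 σ k h fun i => (y i).2)
  comp_act_right k h τ x y := Prod.ext rfl (perm_comp_sum x.2 k h (fun i => (y i).2) τ)
  assoc k hk l p hl h h' x y z := by
    refine Prod.ext ?_ (perm_assoc x.2 k hk (fun i => (y i).2) l p hl h h' fun i j => (z i j).2)
    refine Eq.trans ?_ (Q.assoc (fun i => k (x.2⁻¹ i)) (sum_perm x.2 hk)
      (fun i j => l (x.2⁻¹ i) ((y (x.2⁻¹ i)).2⁻¹ j)) (fun i => p (x.2⁻¹ i))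
      (fun i => sum_perm _ (hl _)) ?_ _ x.1 (fun i => (y (x.2⁻¹ i)).1)
      (fun i j => (z (x.2⁻¹ i) ((y (x.2⁻¹ i)).2⁻¹ j)).1))
    · refine Q.comp_congr _ _ _ _ _ fun s => ?_
      obtain ⟨⟨i, j⟩, rfl⟩ := (blockEquiv (fun i => k (x.2⁻¹ i)) (sum_perm x.2 hk)).surjective s
      have e1 := perm_inv_apply x.2 k hk (fun i => (y i).2) i j
      have e2 := congrArg (blockEquiv k hk).symm e1
      rw [Equiv.symm_apply_apply] at e2
      have e3 := congrArg (fun t : Σ i, Fin (k i) =>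
        (⟨l t.1 t.2, (z t.1 t.2).1⟩ : Σ a, Q.obj a)) e2
      refine e3.trans ?_
      have e4 := congrArg (fun t : Σ i, Fin (k (x.2⁻¹ i)) =>
        (⟨l (x.2⁻¹ t.1) ((y (x.2⁻¹ t.1)).2⁻¹ t.2),
          (z (x.2⁻¹ t.1) ((y (x.2⁻¹ t.1)).2⁻¹ t.2)).1⟩ : Σ a, Q.obj a))
        ((blockEquiv (fun i => k (x.2⁻¹ i)) (sum_perm x.2 hk)).symm_apply_apply ⟨i, j⟩)
      exact e4.symm
    · have e := Equiv.sum_comp (blockEquiv (fun i => k (x.2⁻¹ i)) (sum_perm x.2 hk)).symm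
        (fun t => l (x.2⁻¹ t.1) ((y (x.2⁻¹ t.1)).2⁻¹ t.2))
      refine e.trans ((Fintype.sum_sigma _).trans ?_)
      rw [← sum_perm x.2 h']
      exact Finset.sum_congr rfl fun i _ =>
        sum_perm (k := l (x.2⁻¹ i)) (y (x.2⁻¹ i)).2 (hl _)

end NSOperad

/-! ### The categorical operad `E P` of a symmetric operad `P`, and `E L V` -/

/-- `E P (n)` is the category with the elements of `P (n)` as objects and exactly one morphism
between any two objects. -/
def SymmOperad.E (P : SymmOperad.{w}) : CatOperad.{0, w} where
  obj n := Codiscrete (P.obj n)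
  one := ⟨P.one⟩
  comp k h := Codiscrete.functor fun p => P.comp k h p.1.as fun i => (p.2 i).as
  act σ := Codiscrete.functorOfFun (P.act σ)
  one_comp h := CategoryTheory.Functor.ext (fun x => congrArg Codiscrete.mk (P.one_comp h x.as)) fun _ _ _ => rfl
  comp_one h := CategoryTheory.Functor.ext (fun x => congrArg Codiscrete.mk (P.comp_one h x.as)) fun _ _ _ => rfl
  assoc k hk l p hl h h' := CategoryTheory.Functor.ext
    (fun x => congrArg Codiscrete.mk (P.assoc k hk l p hl h h' x.1.as (fun i => (x.2.1 i).as)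
      fun i j => (x.2.2 i j).as)) fun _ _ _ => rfl
  act_one := CategoryTheory.Functor.ext (fun x => congrArg Codiscrete.mk (P.act_one x.as)) fun _ _ _ => rfl
  act_mul σ τ := CategoryTheory.Functor.ext (fun x => congrArg Codiscrete.mk (P.act_mul σ τ x.as)) fun _ _ _ => rfl
  comp_act_left σ k h := CategoryTheory.Functor.ext (fun x => congrArg Codiscrete.mk
    (P.comp_act_left σ k h x.1.as fun i => (x.2 i).as)) fun _ _ _ => rfl
  comp_act_right k h τ := CategoryTheory.Functor.ext (fun x => congrArg Codiscrete.mk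
    (P.comp_act_right k h τ x.1.as fun i => (x.2 i).as)) fun _ _ _ => rfl

/-- The categorical operad `ELV`. -/
def ELV : CatOperad.{0, 0} := operadV.L.E

/-- An element `t` of `V n`, together with a permutation, as an object of `ELV (n)`. -/
def ELV.mk (n : ℕ) (t : Paren) (h : t.deg = n) (σ : Equiv.Perm (Fin n)) : ELV.obj n :=
  Codiscrete.mk (α := V n × Equiv.Perm (Fin n)) (⟨t, h⟩, σ)

/-- The unique morphism between two objects of `ELV (n)`. -/
def ELV.hom {n : ℕ} (x y : ELV.obj n) : x ⟶ y :=
  (Codiscrete.iso (A := V n × Equiv.Perm (Fin n)) x y).hom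

/-! ### Algebras over a categorical operad -/

namespace CatOperad

/-- An algebra structure on the category `C` over the categorical operad `O`: functors
`O (n) × C ^ n ⥤ C` that are unital, associative and equivariant. -/
structure Algebra (O : CatOperad.{v₁, u₁}) (C : Type u) [Category.{v} C] where
  act (n : ℕ) : O.obj n × (Fin n → C) ⥤ C
  one_act : Functor.pi' (fun _ : Fin 1 => 𝟭 C) ⋙ Prod.sectR O.one (Fin 1 → C) ⋙ act 1 = 𝟭 C
  comp_act {n m : ℕ} (k : Fin n → ℕ) (h : ∑ i, k i = m) :
    (O.comp k h).prod (𝟭 (Fin m → C)) ⋙ act m =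
      prod.associator (O.obj n) (∀ i, O.obj (k i)) (Fin m → C) ⋙
        (𝟭 (O.obj n)).prod
          ((𝟭 (∀ i, O.obj (k i))).prod (splitFunctor C k h) ⋙
            zipFunctor (fun i => O.obj (k i)) (fun i => Fin (k i) → C) ⋙
            Functor.pi (fun i => act (k i))) ⋙
        act n
  perm_act {n : ℕ} (σ : Equiv.Perm (Fin n)) :
    (O.act σ).prod (𝟭 (Fin n → C)) ⋙ act n =
      (𝟭 (O.obj n)).prod (permFunctor C σ) ⋙ act n

/-- A functor `F` is a map of `O`-algebras if it commutes strictly with all the actions. -/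
def Algebra.IsMap {O : CatOperad.{v₁, u₁}} {C D : Type u} [Category.{v} C] [Category.{v} D]
    (A : O.Algebra C) (B : O.Algebra D) (F : C ⥤ D) : Prop :=
  ∀ n : ℕ, A.act n ⋙ F =
    (𝟭 (O.obj n)).prod (Functor.pi (fun _ : Fin n => F)) ⋙ B.act n

/-- An `O`-algebra: a category with an `O`-algebra structure. -/
structure AlgebraCat (O : CatOperad.{v₁, u₁}) where
  carrier : Type u
  [cat : Category.{v} carrier]
  str : O.Algebra carrier

attribute [instance] AlgebraCat.cat

/-- A map of `O`-algebras. -/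
@[ext]
structure AlgebraCat.Hom {O : CatOperad.{v₁, u₁}} (X Y : AlgebraCat.{v, u} O) where
  functor : X.carrier ⥤ Y.carrier
  isMap : X.str.IsMap Y.str functor

/-- The category of `O`-algebras and maps of `O`-algebras. -/
instance (O : CatOperad.{v₁, u₁}) : Category (AlgebraCat.{v, u} O) where
  Hom := AlgebraCat.Hom
  id X := ⟨𝟭 X.carrier, fun _ => rfl⟩
  comp {X Y Z} F G := ⟨F.functor ⋙ G.functor, fun n => by
    rw [← Functor.assoc, F.isMap n, Functor.assoc, G.isMap n]; rfl⟩

/-- The underlying category of an `O`-algebra. -/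
def AlgebraCat.forget (O : CatOperad.{v₁, u₁}) : AlgebraCat.{v, u} O ⥤ Cat.{v, u} where
  obj X := Cat.of X.carrier
  map F := F.functor.toCatHom

end CatOperad

/-! ### Non-unital symmetric monoidal categories -/

/-- A non-unital symmetric monoidal structure on the category `C`: a product functor
`C × C ⥤ C`, written `(a, b) ↦ a ⊗ b` in the comments below, with natural associativity and
commutativity isomorphisms that satisfy the coherence conditions for a symmetric monoidal category
not involving the unit. -/
structure NonunitalSymmetricMonoidal (C : Type u) [Category.{v} C] where
  tensor : C × C ⥤ C
  /-- `(a ⊗ b) ⊗ c ≅ a ⊗ (b ⊗ c)` -/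
  associator (a b c : C) : tensor.obj (tensor.obj (a, b), c) ≅ tensor.obj (a, tensor.obj (b, c))
  /-- `a ⊗ b ≅ b ⊗ a` -/
  braiding (a b : C) : tensor.obj (a, b) ≅ tensor.obj (b, a)
  associator_naturality {a a' b b' c c' : C} (f : a ⟶ a') (g : b ⟶ b') (h : c ⟶ c') :
    tensor.map (Prod.mkHom (tensor.map (Prod.mkHom f g)) h) ≫ (associator a' b' c').hom =
      (associator a b c).hom ≫ tensor.map (Prod.mkHom f (tensor.map (Prod.mkHom g h)))
  braiding_naturality {a a' b b' : C} (f : a ⟶ a') (g : b ⟶ b') :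
    tensor.map (Prod.mkHom f g) ≫ (braiding a' b').hom =
      (braiding a b).hom ≫ tensor.map (Prod.mkHom g f)
  symmetry (a b : C) : (braiding a b).hom ≫ (braiding b a).hom = 𝟙 (tensor.obj (a, b))
  pentagon (a b c d : C) :
    tensor.map (Prod.mkHom (associator a b c).hom (𝟙 d)) ≫
        (associator a (tensor.obj (b, c)) d).hom ≫
        tensor.map (Prod.mkHom (𝟙 a) (associator b c d).hom) =
      (associator (tensor.obj (a, b)) c d).hom ≫ (associator a b (tensor.obj (c, d))).hom
  hexagon (a b c : C) :
    (associator a b c).hom ≫ (braiding a (tensor.obj (b, c))).hom ≫ (associator b c a).hom =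
      tensor.map (Prod.mkHom (braiding a b).hom (𝟙 c)) ≫ (associator b a c).hom ≫
        tensor.map (Prod.mkHom (𝟙 b) (braiding a c).hom)

namespace NonunitalSymmetricMonoidal

/-- A functor `F` is strict if it strictly preserves the product and the associativity and
commutativity isomorphisms.  Equality in the arrow category means equality of morphisms
together with their sources and targets. -/
structure IsStrictMap {C D : Type u} [Category.{v} C] [Category.{v} D]
    (M : NonunitalSymmetricMonoidal C) (N : NonunitalSymmetricMonoidal D) (F : C ⥤ D) : Prop where
  map_tensor : M.tensor ⋙ F = F.prod F ⋙ N.tensor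
  map_associator (a b c : C) : Arrow.mk (F.map (M.associator a b c).hom) =
    Arrow.mk (N.associator (F.obj a) (F.obj b) (F.obj c)).hom
  map_braiding (a b : C) : Arrow.mk (F.map (M.braiding a b).hom) =
    Arrow.mk (N.braiding (F.obj a) (F.obj b)).hom

theorem IsStrictMap.id {C : Type u} [Category.{v} C] (M : NonunitalSymmetricMonoidal C) :
    M.IsStrictMap M (𝟭 C) :=
  ⟨rfl, fun _ _ _ => rfl, fun _ _ => rfl⟩

theorem IsStrictMap.comp {C D E : Type u} [Category.{v} C] [Category.{v} D] [Category.{v} E]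
    {M : NonunitalSymmetricMonoidal C} {N : NonunitalSymmetricMonoidal D}
    {P : NonunitalSymmetricMonoidal E} {F : C ⥤ D} {G : D ⥤ E}
    (hF : M.IsStrictMap N F) (hG : N.IsStrictMap P G) : M.IsStrictMap P (F ⋙ G) where
  map_tensor := by
    rw [← Functor.assoc, hF.map_tensor, Functor.assoc, hG.map_tensor]; rfl
  map_associator a b c :=
    (congrArg G.mapArrow.obj (hF.map_associator a b c)).trans (hG.map_associator _ _ _)
  map_braiding a b :=
    (congrArg G.mapArrow.obj (hF.map_braiding a b)).trans (hG.map_braiding _ _)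

end NonunitalSymmetricMonoidal

/-- A non-unital symmetric monoidal category. -/
structure NonunitalSymMonCat where
  carrier : Type u
  [cat : Category.{v} carrier]
  str : NonunitalSymmetricMonoidal carrier

attribute [instance] NonunitalSymMonCat.cat

namespace NonunitalSymMonCat

/-- A strict map of non-unital symmetric monoidal categories. -/
@[ext]
structure Hom (X Y : NonunitalSymMonCat.{v, u}) where
  functor : X.carrier ⥤ Y.carrier
  isStrictMap : X.str.IsStrictMap Y.str functor

/-- The category of non-unital symmetric monoidal categories and strict maps. -/
instance : Category NonunitalSymMonCat.{v, u} where
  Hom := Hom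
  id X := ⟨𝟭 X.carrier, .id X.str⟩
  comp F G := ⟨F.functor ⋙ G.functor, F.isStrictMap.comp G.isStrictMap⟩

/-- The underlying category. -/
def forget : NonunitalSymMonCat.{v, u} ⥤ Cat.{v, u} where
  obj X := Cat.of X.carrier
  map F := F.functor.toCatHom

end NonunitalSymMonCat

/-- The functor `C × C ⥤ C ^ 2`, `(a, b) ↦ (a, b)`. -/
def pairFunctor (C : Type u) [Category.{v} C] : C × C ⥤ (Fin 2 → C) :=
  Functor.pi' (fun i => ![CategoryTheory.Prod.fst C C, CategoryTheory.Prod.snd C C] i)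

open Paren in
/-- The non-unital symmetric monoidal structure `M` is the one given by the `ELV`-algebra
structure `A`: the product is the action of `(1,1)`, the associativity isomorphism is the image of
the unique morphism `((1,1),1) ⟶ (1,(1,1))` of `ELV (3)`, and the commutativity isomorphism is
the image of the unique morphism `((1,1), id) ⟶ ((1,1), t)` of `ELV (2)`, where `t` is the
transposition. -/
structure IsInducedBy {C : Type u} [Category.{v} C] (M : NonunitalSymmetricMonoidal C)
    (A : ELV.Algebra C) : Prop where
  tensor_eq : M.tensor =
    pairFunctor C ⋙ Prod.sectR (ELV.mk 2 (pair one one) rfl 1) (Fin 2 → C) ⋙ A.act 2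
  associator_eq (a b c : C) : Arrow.mk (M.associator a b c).hom =
    Arrow.mk ((A.act 3).map (Prod.mkHom
      (ELV.hom (ELV.mk 3 (pair (pair one one) one) rfl 1) (ELV.mk 3 (pair one (pair one one)) rfl 1))
      (𝟙 (![a, b, c] : Fin 3 → C))))
  braiding_eq (a b : C) : Arrow.mk (M.braiding a b).hom =
    Arrow.mk ((A.act 2).map (Prod.mkHom
      (ELV.hom (ELV.mk 2 (pair one one) rfl 1) (ELV.mk 2 (pair one one) rfl (Equiv.swap 0 1)))
      (𝟙 (![a, b] : Fin 2 → C))))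

end SymMonOperads

namespace SymMonOperads

/-! ### Morphisms up to equality of their sources and targets -/

section ArrowEquality

variable {C : Type u} [Category.{v} C] {D : Type u₁} [Category.{v₁} D]

/-! An object of `ELV (n)` is the same as a parenthesized word in which each of the letters 0, …,
n-1 occurs exactly once (`ELV.word`). Operadic composition becomes substitution of words
(`ELV.word_comp`), and the symmetric group acts by renaming letters (`ELV.word_act`). The theorem is
thus a form of Mac Lane's coherence theorem: evaluating such words gives an action of the objects,
and coherence says that it extends in exactly one way to the unique morphisms between them.

From a monoidal structure to an algebra, two facts are needed. Existence: words with the same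
letters up to order are joined by a formal composite of associators and braidings
(`Word.nonempty_formal`). Uniqueness: two parallel formal composites between words without repeated
letters have the same value (`NonunitalSymmetricMonoidal.evFormal_eq`); repeated letters must be
excluded, since the braiding of an object with itself need not be the identity. Uniqueness is first
proved in a symmetric monoidal category with unit. There the letters of a word are moved one by one
into a strictly increasing list by canonical isomorphisms, and `IsSorting.formal` shows that
precomposing a sorting isomorphism with a formal composite gives a sorting isomorphism again. As
sorting isomorphisms are unique and invertible, parallel formal composites agree. The unit serves as
the empty list. In the non-unital case an isolated strict unit is adjoined; the inclusion is strict
and the identity on morphisms, so the result descends.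

From an algebra to a monoidal structure, the axioms hold because parallel morphisms of `ELV (n)` are
equal. The main point is that the value of every formal composite is the image of the unique
morphism between the words at its ends (`ELVAlgebra.arrow_evFormal`). It is proved by induction
through the relation `Realizes`, which allows the letters to be renamed and is closed under
composition and under the action. The same fact shows that the algebra is recovered from its
product, associator and braiding, so that the two constructions are inverse to each other.

Strict equalities of functors often relate morphisms whose ends are only provably equal. Such
morphisms are compared as objects of the arrow category. -/

theorem arrow_comp {X Y Z X' Y' Z' : C} {f : X ⟶ Y} {g : Y ⟶ Z} {f' : X' ⟶ Y'} {g' : Y' ⟶ Z'}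
    (hf : Arrow.mk f = Arrow.mk f') (hg : Arrow.mk g = Arrow.mk g') :
    Arrow.mk (f ≫ g) = Arrow.mk (f' ≫ g') := by
  cases hf
  cases hg
  rfl

theorem arrow_id {X Y : C} (h : X = Y) : Arrow.mk (𝟙 X) = Arrow.mk (𝟙 Y) := by rw [h]

theorem arrow_map (F : C ⥤ D) {X Y X' Y' : C} {f : X ⟶ Y} {f' : X' ⟶ Y'}
    (h : Arrow.mk f = Arrow.mk f') : Arrow.mk (F.map f) = Arrow.mk (F.map f') :=
  congrArg F.mapArrow.obj h

theorem arrow_injective {X Y : C} {f g : X ⟶ Y} (h : Arrow.mk f = Arrow.mk g) : f = g := by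
  cases h
  rfl

theorem arrow_source {X Y X' Y' : C} {f : X ⟶ Y} {f' : X' ⟶ Y'} (h : Arrow.mk f = Arrow.mk f') :
    X = X' := congrArg (fun a : Arrow C => a.left) h

theorem arrow_target {X Y X' Y' : C} {f : X ⟶ Y} {f' : X' ⟶ Y'} (h : Arrow.mk f = Arrow.mk f') :
    Y = Y' := congrArg (fun a : Arrow C => a.right) h

theorem arrow_prod {X Y X' Y' : C} {f : X ⟶ Y} {f' : X' ⟶ Y'} {Z W Z' W' : D} {g : Z ⟶ W}
    {g' : Z' ⟶ W'} (hf : Arrow.mk f = Arrow.mk f') (hg : Arrow.mk g = Arrow.mk g') :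
    Arrow.mk (Prod.mkHom f g) = Arrow.mk (Prod.mkHom f' g') := by
  cases hf
  cases hg
  rfl

theorem arrow_pi {ι : Type w} {A : ι → Type u} [∀ i, Category.{v} (A i)] {X Y X' Y' : ∀ i, A i}
    {f : X ⟶ Y} {f' : X' ⟶ Y'} (h : ∀ i, Arrow.mk (f i) = Arrow.mk (f' i)) :
    Arrow.mk f = Arrow.mk f' := by
  obtain rfl : X = X' := funext fun i => arrow_source (h i)
  obtain rfl : Y = Y' := funext fun i => arrow_target (h i)
  obtain rfl : f = f' := funext fun i => arrow_injective (h i)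
  rfl

/-- A left inverse and a right inverse of one morphism coincide. This carries a statement about
`hom` over to `inv`. -/
theorem arrow_inv {X Y X' Y' : C} {f : X ⟶ Y} {g : Y ⟶ X} {f' : X' ⟶ Y'} {g' : Y' ⟶ X'}
    (h : Arrow.mk f = Arrow.mk f') (hf : f ≫ g = 𝟙 X) (hf' : g' ≫ f' = 𝟙 Y') :
    Arrow.mk g = Arrow.mk g' := by
  cases h
  congr 1
  rw [← Category.id_comp g, ← hf', Category.assoc, hf, Category.comp_id]

theorem arrow_eqToHom_comp {X Y Z : C} (h : X = Y) (f : Y ⟶ Z) :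
    Arrow.mk (eqToHom h ≫ f) = Arrow.mk f := by
  subst h
  rw [eqToHom_refl, Category.id_comp]

theorem arrow_comp_eqToHom {X Y Z : C} (f : X ⟶ Y) (h : Y = Z) :
    Arrow.mk (f ≫ eqToHom h) = Arrow.mk f := by
  subst h
  rw [eqToHom_refl, Category.comp_id]

theorem arrow_heq {X Y X' Y' : C} {f : X ⟶ Y} {f' : X' ⟶ Y'} (h : Arrow.mk f = Arrow.mk f') :
    f ≍ f' := by
  cases h
  rfl

/-- The identities already force agreement on objects, so a strict equality of functors can be
checked on morphisms alone, without transports. -/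
theorem functor_eq_of_arrow {F G : C ⥤ D}
    (h : ∀ {X Y : C} (f : X ⟶ Y), Arrow.mk (F.map f) = Arrow.mk (G.map f)) : F = G :=
  Functor.hext (fun X => arrow_source (h (𝟙 X))) fun _ _ f => arrow_heq (h f)

theorem arrow_of_functor_eq {F G : C ⥤ D} (h : F = G) {X Y : C} (f : X ⟶ Y) :
    Arrow.mk (F.map f) = Arrow.mk (G.map f) := by rw [h]

end ArrowEquality

/-! ### Words and formal composites -/

/-- Parenthesized nonempty words with letters in `S`. -/
inductive Word (S : Type w) : Type w
  | of : S → Word S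
  | mul : Word S → Word S → Word S

namespace Word

variable {S : Type w} {S' S'' : Type*}

/-- The list of letters of a word. -/
def letters : Word S → List S
  | of a => [a]
  | mul x y => x.letters ++ y.letters

/-- Substitution of words for the letters of a word. -/
def subst (g : S → Word S') : Word S → Word S'
  | of a => g a
  | mul x y => mul (x.subst g) (y.subst g)

/-- Renaming of the letters of a word. -/
def rename (g : S → S') : Word S → Word S' := subst fun s => of (g s)

theorem subst_subst (g : S → Word S') (g' : S' → Word S'') (x : Word S) :
    (x.subst g).subst g' = x.subst fun s => (g s).subst g' := by
  induction x with
  | of a => rfl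
  | mul x y hx hy => simp only [subst, hx, hy]

/-- Formal composites of instances of associativity and commutativity isomorphisms. -/
inductive Formal : Word S → Word S → Type w
  | id (x) : Formal x x
  | comp {x y z} : Formal x y → Formal y z → Formal x z
  | mul {x y x' y'} : Formal x x' → Formal y y' → Formal (mul x y) (mul x' y')
  | assoc (x y z) : Formal (mul (mul x y) z) (mul x (mul y z))
  | assocInv (x y z) : Formal (mul x (mul y z)) (mul (mul x y) z)
  | braid (x y) : Formal (mul x y) (mul y x)

/-- Substitution in a formal composite. -/
def Formal.subst (g : S → Word S') : {x y : Word S} → Formal x y → Formal (x.subst g) (y.subst g)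
  | _, _, id _ => id _
  | _, _, comp p q => comp (p.subst g) (q.subst g)
  | _, _, mul p q => mul (p.subst g) (q.subst g)
  | _, _, assoc _ _ _ => assoc _ _ _
  | _, _, assocInv _ _ _ => assocInv _ _ _
  | _, _, braid _ _ => braid _ _

/-- Substitution of formal composites for the letters of a word. -/
def Formal.substMap {g g' : S → Word S'} (q : ∀ s, Formal (g s) (g' s)) :
    (x : Word S) → Formal (x.subst g) (x.subst g')
  | of a => q a
  | Word.mul x y => mul (substMap q x) (substMap q y)

/-- The right-bracketed word with first letter `a` and the other letters in `l`. -/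
def rightBracketed : S → List S → Word S
  | a, [] => of a
  | a, b :: l => mul (of a) (rightBracketed b l)

/-- One associator for each letter of `l` moves that letter out of the left factor. -/
theorem nonempty_formal_append (a : S) (l : List S) (b : S) (l' : List S) :
    Nonempty (Formal (mul (rightBracketed a l) (rightBracketed b l'))
      (rightBracketed a (l ++ b :: l'))) := by
  induction l generalizing a with
  | nil => exact ⟨.id _⟩
  | cons c l ih =>
    obtain ⟨p⟩ := ih c
    exact ⟨.comp (.assoc _ _ _) (.mul (.id _) p)⟩

/-- The inverse of a formal composite. -/
def Formal.inv : {x y : Word S} → Formal x y → Formal y x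
  | _, _, id _ => id _
  | _, _, comp p q => comp q.inv p.inv
  | _, _, mul p q => mul p.inv q.inv
  | _, _, assoc _ _ _ => assocInv _ _ _
  | _, _, assocInv _ _ _ => assoc _ _ _
  | _, _, braid _ _ => braid _ _

theorem exists_rightBracketed (x : Word S) : ∃ a l, x.letters = a :: l ∧
    Nonempty (Formal x (rightBracketed a l)) := by
  induction x with
  | of a => exact ⟨a, [], rfl, ⟨.id _⟩⟩
  | mul x y hx hy =>
    obtain ⟨a, l, h, ⟨p⟩⟩ := hx
    obtain ⟨b, l', h', ⟨q⟩⟩ := hy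
    obtain ⟨r⟩ := nonempty_formal_append a l b l'
    exact ⟨a, l ++ b :: l', by simp [letters, h, h'], ⟨.comp (.mul p q) r⟩⟩

/-- Induction on the derivation of the permutation. A word has at least one letter, so both lists
are presented with a head, and the empty cases are contradictory. -/
theorem nonempty_formal_of_perm {L L' : List S} (h : L.Perm L') :
    ∀ {a l a' l'}, L = a :: l → L' = a' :: l' →
      Nonempty (Formal (rightBracketed a l) (rightBracketed a' l')) := by
  induction h with
  | nil => intro _ _ _ _ h; cases h
  | @cons c l₁ l₂ h ih =>
    rintro _ _ _ _ ⟨⟩ ⟨⟩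
    cases l₁ with
    | nil =>
      obtain rfl := h.nil_eq
      exact ⟨.id _⟩
    | cons b l =>
      cases l₂ with
      | nil => cases h.eq_nil
      | cons b' l' =>
        obtain ⟨p⟩ := ih rfl rfl
        exact ⟨.mul (.id _) p⟩
  | swap b c l =>
    rintro _ _ _ _ ⟨⟩ ⟨⟩
    cases l with
    | nil => exact ⟨.braid _ _⟩
    | cons d l =>
      -- With letters remaining behind the two that are exchanged, the braiding has to be conjugated
      -- by associators.
      exact ⟨.comp (.assocInv _ _ _) (.comp (.mul (.braid _ _) (.id _)) (.assoc _ _ _))⟩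
  | @trans l₁ l₂ l₃ h h' ih ih' =>
    rintro a l a' l' rfl rfl
    cases l₂ with
    | nil => cases h.eq_nil
    | cons b m =>
      obtain ⟨p⟩ := ih rfl rfl
      obtain ⟨q⟩ := ih' rfl rfl
      exact ⟨.comp p q⟩

/-- Associativity brings both words to right-bracketed form, and transpositions of neighbours relate
the two forms. -/
theorem nonempty_formal {x y : Word S} (h : x.letters.Perm y.letters) : Nonempty (Formal x y) := by
  obtain ⟨a, l, hx, ⟨p⟩⟩ := exists_rightBracketed x
  obtain ⟨b, l', hy, ⟨q⟩⟩ := exists_rightBracketed y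
  obtain ⟨r⟩ := nonempty_formal_of_perm h hx hy
  exact ⟨.comp p (.comp r q.inv)⟩

end Word

/-! ### Evaluation of words and of formal composites -/

/-- A product with associativity and commutativity isomorphisms, without any laws. -/
structure ProductData (C : Type u) [Category.{v} C] where
  tensor : C × C ⥤ C
  associator (a b c : C) : tensor.obj (tensor.obj (a, b), c) ≅ tensor.obj (a, tensor.obj (b, c))
  braiding (a b : C) : tensor.obj (a, b) ≅ tensor.obj (b, a)

/-- The data of a non-unital symmetric monoidal structure. -/
def NonunitalSymmetricMonoidal.toProductData {C : Type u} [Category.{v} C]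
    (M : NonunitalSymmetricMonoidal C) : ProductData C :=
  ⟨M.tensor, M.associator, M.braiding⟩

/-- The object obtained by evaluating a word at a family of objects. -/
def wordObj {C : Type u} [Category.{v} C] (T : C × C ⥤ C) {S : Type w} (c : S → C) : Word S → C
  | .of a => c a
  | .mul x y => T.obj (wordObj T c x, wordObj T c y)

/-- Functoriality of the evaluation of words. -/
def wordMap {C : Type u} [Category.{v} C] (T : C × C ⥤ C) {S : Type w} {c c' : S → C} (f : c ⟶ c') :
    (x : Word S) → (wordObj T c x ⟶ wordObj T c' x)
  | .of a => f a
  | .mul x y => T.map (Prod.mkHom (wordMap T f x) (wordMap T f y))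

namespace ProductData

variable {C : Type u} [Category.{v} C] (M : ProductData C) {S : Type w} {S' : Type*}

/-- The object obtained by evaluating a word at a family of objects. -/
abbrev ev (c : S → C) (x : Word S) : C := wordObj M.tensor c x

/-- Functoriality of the evaluation of words. -/
abbrev evMap {c c' : S → C} (f : c ⟶ c') (x : Word S) : M.ev c x ⟶ M.ev c' x :=
  wordMap M.tensor f x

/-- The morphism obtained by evaluating a formal composite. -/
def evFormal (c : S → C) : {x y : Word S} → Word.Formal x y → (M.ev c x ⟶ M.ev c y)
  | _, _, .id x => 𝟙 (M.ev c x)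
  | _, _, .comp p q => evFormal c p ≫ evFormal c q
  | _, _, .mul p q => M.tensor.map (Prod.mkHom (evFormal c p) (evFormal c q))
  | _, _, .assoc x y z => (M.associator (M.ev c x) (M.ev c y) (M.ev c z)).hom
  | _, _, .assocInv x y z => (M.associator (M.ev c x) (M.ev c y) (M.ev c z)).inv
  | _, _, .braid x y => (M.braiding (M.ev c x) (M.ev c y)).hom

theorem evMap_id (c : S → C) (x : Word S) : M.evMap (𝟙 c) x = 𝟙 (M.ev c x) := by
  induction x with
  | of a => rfl
  | mul x y hx hy =>
    simp only [evMap, wordMap] at *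
    rw [hx, hy]
    exact M.tensor.map_id _

theorem evMap_comp {c c' c'' : S → C} (f : c ⟶ c') (g : c' ⟶ c'') (x : Word S) :
    M.evMap (f ≫ g) x = M.evMap f x ≫ M.evMap g x := by
  induction x with
  | of a => rfl
  | mul x y hx hy =>
    simp only [evMap, wordMap] at *
    rw [hx, hy]
    exact M.tensor.map_comp (Prod.mkHom _ _) (Prod.mkHom _ _)

theorem arrow_tensor {X Y X' Y' Z W Z' W' : C} {f : X ⟶ Y} {f' : X' ⟶ Y'} {g : Z ⟶ W}
    {g' : Z' ⟶ W'} (hf : Arrow.mk f = Arrow.mk f') (hg : Arrow.mk g = Arrow.mk g') :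
    Arrow.mk (M.tensor.map (Prod.mkHom f g)) = Arrow.mk (M.tensor.map (Prod.mkHom f' g')) :=
  arrow_map M.tensor (arrow_prod hf hg)

theorem evMap_subst (g : S → Word S') {c c' : S' → C} (f : c ⟶ c') (x : Word S) :
    Arrow.mk (M.evMap f (x.subst g)) =
      Arrow.mk (M.evMap (c := fun s => M.ev c (g s)) (c' := fun s => M.ev c' (g s))
        (fun s => M.evMap f (g s)) x) := by
  induction x with
  | of a => rfl
  | mul x y hx hy => exact M.arrow_tensor hx hy

theorem ev_subst (g : S → Word S') (c : S' → C) (x : Word S) :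
    M.ev c (x.subst g) = M.ev (fun s => M.ev c (g s)) x := by
  induction x with
  | of a => rfl
  | mul x y hx hy => simp only [Word.subst, ev, wordObj] at *; rw [hx, hy]

theorem arrow_associator {a b c a' b' c' : C} (ha : a = a') (hb : b = b') (hc : c = c') :
    Arrow.mk (M.associator a b c).hom = Arrow.mk (M.associator a' b' c').hom := by
  subst ha hb hc; rfl

theorem arrow_associator_inv {a b c a' b' c' : C} (ha : a = a') (hb : b = b') (hc : c = c') :
    Arrow.mk (M.associator a b c).inv = Arrow.mk (M.associator a' b' c').inv := by
  subst ha hb hc; rfl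

theorem arrow_braiding {a b a' b' : C} (ha : a = a') (hb : b = b') :
    Arrow.mk (M.braiding a b).hom = Arrow.mk (M.braiding a' b').hom := by
  subst ha hb; rfl

/-- Evaluation is compositional: substituting words and then evaluating amounts to evaluating at the
values of these words. The ends agree only by `ev_subst`, hence the equality of arrows. -/
theorem evFormal_subst (g : S → Word S') (c : S' → C) {x y : Word S} (p : Word.Formal x y) :
    Arrow.mk (M.evFormal c (p.subst g)) = Arrow.mk (M.evFormal (fun s => M.ev c (g s)) p) := by
  induction p with
  | id x => exact arrow_id (M.ev_subst g c x)
  | comp p q hp hq => exact arrow_comp hp hq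
  | mul p q hp hq => exact M.arrow_tensor hp hq
  | assoc x y z => exact M.arrow_associator (M.ev_subst ..) (M.ev_subst ..) (M.ev_subst ..)
  | assocInv x y z => exact M.arrow_associator_inv (M.ev_subst ..) (M.ev_subst ..) (M.ev_subst ..)
  | braid x y => exact M.arrow_braiding (M.ev_subst ..) (M.ev_subst ..)

theorem evFormal_substMap {g g' : S → Word S'} (q : ∀ s, Word.Formal (g s) (g' s)) (c : S' → C)
    (x : Word S) : Arrow.mk (M.evFormal c (Word.Formal.substMap q x)) =
      Arrow.mk (M.evMap (c := fun s => M.ev c (g s)) (c' := fun s => M.ev c (g' s))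
        (fun s => M.evFormal c (q s)) x) := by
  induction x with
  | of a => rfl
  | mul x y hx hy => exact M.arrow_tensor hx hy

theorem arrow_ev {c c' d d' : S → C} {f : c ⟶ c'} {g : d ⟶ d'}
    (h : ∀ s, Arrow.mk (f s) = Arrow.mk (g s)) (x : Word S) :
    Arrow.mk (M.evMap f x) = Arrow.mk (M.evMap g x) := by
  have := arrow_pi h
  cases this
  rfl

/-- Strict preservation of the product and of the isomorphisms. -/
structure IsStrict {D : Type u₁} [Category.{v₁} D] (N : ProductData D) (F : C ⥤ D) : Prop where
  map_tensor : M.tensor ⋙ F = F.prod F ⋙ N.tensor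
  map_associator (a b c : C) : Arrow.mk (F.map (M.associator a b c).hom) =
    Arrow.mk (N.associator (F.obj a) (F.obj b) (F.obj c)).hom
  map_braiding (a b : C) : Arrow.mk (F.map (M.braiding a b).hom) =
    Arrow.mk (N.braiding (F.obj a) (F.obj b)).hom

/-! ### Strict functors commute with evaluation -/

section Strict

variable {M} {D : Type u₁} [Category.{v₁} D] {N : ProductData D} {F : C ⥤ D}

theorem IsStrict.evMap (h : M.IsStrict N F) {c c' : S → C} (f : c ⟶ c') (x : Word S) :
    Arrow.mk (F.map (M.evMap f x)) =
      Arrow.mk (N.evMap (c := fun s => F.obj (c s)) (c' := fun s => F.obj (c' s))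
        (fun s => F.map (f s)) x) := by
  induction x with
  | of a => rfl
  | mul x y hx hy => exact (arrow_of_functor_eq h.map_tensor _).trans (N.arrow_tensor hx hy)

theorem IsStrict.ev (h : M.IsStrict N F) (c : S → C) (x : Word S) :
    F.obj (M.ev c x) = N.ev (fun s => F.obj (c s)) x :=
  arrow_source (h.evMap (𝟙 c) x)

theorem IsStrict.evFormal (h : M.IsStrict N F) (c : S → C) {x y : Word S} (p : Word.Formal x y) :
    Arrow.mk (F.map (M.evFormal c p)) = Arrow.mk (N.evFormal (fun s => F.obj (c s)) p) := by
  induction p with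
  | id x => exact (congrArg Arrow.mk (F.map_id _)).trans (arrow_id (h.ev c x))
  | comp p q hp hq => exact (congrArg Arrow.mk (F.map_comp _ _)).trans (arrow_comp hp hq)
  | mul p q hp hq => exact (arrow_of_functor_eq h.map_tensor _).trans (N.arrow_tensor hp hq)
  | assoc x y z =>
    exact (h.map_associator _ _ _).trans (N.arrow_associator (h.ev c x) (h.ev c y) (h.ev c z))
  | assocInv x y z =>
    -- Strictness speaks only of the forward associator; uniqueness of inverses gives the other
    -- direction.
    exact arrow_inv ((h.map_associator _ _ _).trans
      (N.arrow_associator (h.ev c x) (h.ev c y) (h.ev c z)))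
      (F.mapIso (M.associator _ _ _)).hom_inv_id (Iso.inv_hom_id _)
  | braid x y => exact (h.map_braiding _ _).trans (N.arrow_braiding (h.ev c x) (h.ev c y))

end Strict

end ProductData

namespace NonunitalSymmetricMonoidal

variable {C : Type u} [Category.{v} C] (M : NonunitalSymmetricMonoidal C) {S : Type w}

theorem evFormal_naturality {c c' : S → C} (f : c ⟶ c') {x y : Word S} (p : Word.Formal x y) :
    M.toProductData.evMap f x ≫ M.toProductData.evFormal c' p =
      M.toProductData.evFormal c p ≫ M.toProductData.evMap f y := by
  induction p with
  | id x => exact (Category.comp_id _).trans (Category.id_comp _).symm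
  | comp p q hp hq =>
    simp only [ProductData.evFormal]
    rw [← Category.assoc, hp, Category.assoc, hq, Category.assoc]
  | mul p q hp hq =>
    refine (M.tensor.map_comp _ _).symm.trans (Eq.trans ?_ (M.tensor.map_comp _ _))
    exact congrArg M.tensor.map (Prod.ext hp hq)
  | assoc x y z => exact M.associator_naturality _ _ _
  | assocInv x y z =>
    exact ((Iso.eq_inv_comp _).2 ((Category.assoc _ _ _).symm.trans ((Iso.comp_inv_eq _).2
      (M.associator_naturality _ _ _).symm)))
  | braid x y => exact M.braiding_naturality _ _

end NonunitalSymmetricMonoidal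

/-! ### Coherence in a symmetric monoidal category -/

section Coherence

open MonoidalCategory

/-! ### Associators in front of sorting maps -/

section

variable {D : Type u} [Category.{v} D] [MonoidalCategory D]

theorem tensorHom_whiskerRight_sorting {X X' Y Y' L M N : D} (p : X ⟶ X') (q : Y ⟶ Y')
    (g : Y' ⊗ L ⟶ M) (k : X' ⊗ M ⟶ N) :
    (p ⊗ₘ q) ▷ L ≫ (α_ X' Y' L).hom ≫ X' ◁ g ≫ k =
      (α_ X Y L).hom ≫ X ◁ (q ▷ L ≫ g) ≫ p ▷ M ≫ k := by
  simp only [MonoidalCategory.tensorHom_def, comp_whiskerRight, Category.assoc,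
    MonoidalCategory.whiskerLeft_comp, associator_naturality_middle_assoc]
  rw [associator_naturality_left_assoc, whisker_exchange_assoc, whisker_exchange_assoc]

/-- The pentagon, in the form needed for the associator case of `IsSorting.formal`. -/
theorem associator_whiskerRight_sorting {X Y Z L M M' N : D} (g : Z ⊗ L ⟶ M') (k : Y ⊗ M' ⟶ M)
    (h : X ⊗ M ⟶ N) :
    (α_ X Y Z).hom ▷ L ≫ (α_ X (Y ⊗ Z) L).hom ≫ X ◁ ((α_ Y Z L).hom ≫ Y ◁ g ≫ k) ≫ h =
      (α_ (X ⊗ Y) Z L).hom ≫ (X ⊗ Y) ◁ g ≫ (α_ X Y M').hom ≫ X ◁ k ≫ h := by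
  simp

theorem associator_inv_whiskerRight_sorting {X Y Z L M M' N : D} (g : Z ⊗ L ⟶ M)
    (k : Y ⊗ M ⟶ M') (h : X ⊗ M' ⟶ N) :
    (α_ X Y Z).inv ▷ L ≫ (α_ (X ⊗ Y) Z L).hom ≫ (X ⊗ Y) ◁ g ≫ (α_ X Y M).hom ≫ X ◁ k ≫ h =
      (α_ X (Y ⊗ Z) L).hom ≫ X ◁ ((α_ Y Z L).hom ≫ Y ◁ g ≫ k) ≫ h := by
  simp

end

/-! ### The interchange of two neighbouring factors -/

variable {D : Type u} [Category.{v} D] [MonoidalCategory D] [SymmetricCategory D] {S : Type w}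

/-- The interchange of the first two factors of `X ⊗ Y ⊗ Z`. -/
def interchange (X Y Z : D) : X ⊗ Y ⊗ Z ⟶ Y ⊗ X ⊗ Z :=
  (α_ X Y Z).inv ≫ (β_ X Y).hom ▷ Z ≫ (α_ Y X Z).hom

theorem interchange_interchange (X Y Z : D) : interchange X Y Z ≫ interchange Y X Z = 𝟙 _ := by
  simp only [interchange, Category.assoc, Iso.hom_inv_id_assoc, ← comp_whiskerRight_assoc,
    SymmetricCategory.symmetry, id_whiskerRight, Category.id_comp, Iso.inv_hom_id]

theorem interchange_interchange_assoc (X Y Z : D) {W : D} (h : X ⊗ Y ⊗ Z ⟶ W) :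
    interchange X Y Z ≫ interchange Y X Z ≫ h = h := by
  rw [← Category.assoc, interchange_interchange, Category.id_comp]

theorem interchange_naturality_right (X Y : D) {Z Z' : D} (f : Z ⟶ Z') :
    X ◁ Y ◁ f ≫ interchange X Y Z' = interchange X Y Z ≫ Y ◁ X ◁ f := by
  simp only [interchange, Category.assoc, associator_inv_naturality_right_assoc,
    whisker_exchange_assoc, associator_naturality_right]

theorem interchange_naturality_right_assoc (X Y : D) {Z Z' : D} (f : Z ⟶ Z') {W : D}
    (h : Y ⊗ X ⊗ Z' ⟶ W) :
    X ◁ Y ◁ f ≫ interchange X Y Z' ≫ h = interchange X Y Z ≫ Y ◁ X ◁ f ≫ h := by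
  rw [← Category.assoc, interchange_naturality_right, Category.assoc]

theorem interchange_naturality_left {X X' : D} (f : X ⟶ X') (Y Z : D) :
    f ▷ (Y ⊗ Z) ≫ interchange X' Y Z = interchange X Y Z ≫ Y ◁ f ▷ Z := by
  simp only [interchange, Category.assoc, associator_inv_naturality_left_assoc,
    ← comp_whiskerRight_assoc, BraidedCategory.braiding_naturality_left]
  simp

theorem interchange_naturality_left_assoc {X X' : D} (f : X ⟶ X') (Y Z : D) {W : D}
    (h : Y ⊗ X' ⊗ Z ⟶ W) :
    f ▷ (Y ⊗ Z) ≫ interchange X' Y Z ≫ h = interchange X Y Z ≫ Y ◁ f ▷ Z ≫ h := by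
  rw [← Category.assoc, interchange_naturality_left, Category.assoc]

/-- A hexagon in terms of interchanges: moving `X ⊗ Y` past `Z` is moving `Y` and then `X` past it.
-/
theorem interchange_tensor_left (X Y Z W : D) :
    (α_ X Y (Z ⊗ W)).hom ≫ X ◁ interchange Y Z W ≫ interchange X Z (Y ⊗ W) =
      interchange (X ⊗ Y) Z W ≫ Z ◁ (α_ X Y W).hom := by
  simp [interchange]

theorem interchange_tensor_right (X Y Z W : D) :
    X ◁ (α_ Y Z W).hom ≫ interchange X Y (Z ⊗ W) ≫ Y ◁ interchange X Z W =
      interchange X (Y ⊗ Z) W ≫ (α_ Y Z (X ⊗ W)).hom := by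
  simp [interchange]

/-- By the hexagon, the first two interchanges on the left move `X ⊗ Y` past `Z` as a whole; the
identity is then naturality of this move with respect to the braiding of `X` and `Y`. -/
theorem interchange_yang_baxter (X Y Z W : D) :
    X ◁ interchange Y Z W ≫ interchange X Z (Y ⊗ W) ≫ Z ◁ interchange X Y W =
      interchange X Y (Z ⊗ W) ≫ Y ◁ interchange X Z W ≫ interchange Y Z (X ⊗ W) := by
  have h := interchange_tensor_left X Y Z W
  have h' := interchange_tensor_left Y X Z W
  rw [← cancel_epi (α_ X Y (Z ⊗ W)).hom]
  simp only [reassoc_of% h]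
  simp only [interchange, Category.assoc, MonoidalCategory.whiskerLeft_comp] at h' ⊢
  simp only [Iso.hom_inv_id_assoc, whiskerLeft_hom_inv_assoc, h']
  simpa [interchange] using (interchange_naturality_left_assoc (β_ X Y).hom Z W
    (Z ◁ (α_ Y X W).hom)).symm

/-- The inductive step of `IsInsertion.exchange`: both inserted letters `X` and `Y` pass the head
`Z` of the list, and Yang–Baxter reorders the three. -/
theorem interchange_exchange (X Y Z : D) {W W₁ W₂ W₃ : D} {f : Y ⊗ W ⟶ W₁} {g : X ⊗ W₁ ⟶ W₃}
    {f' : X ⊗ W ⟶ W₂} {g' : Y ⊗ W₂ ⟶ W₃}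
    (h : X ◁ f ≫ g = interchange X Y W ≫ Y ◁ f' ≫ g') :
    X ◁ (interchange Y Z W ≫ Z ◁ f) ≫ interchange X Z W₁ ≫ Z ◁ g =
      interchange X Y (Z ⊗ W) ≫ Y ◁ (interchange X Z W ≫ Z ◁ f') ≫
        interchange Y Z W₂ ≫ Z ◁ g' := by
  simp only [MonoidalCategory.whiskerLeft_comp, Category.assoc,
    interchange_naturality_right_assoc]
  rw [← MonoidalCategory.whiskerLeft_comp, h, MonoidalCategory.whiskerLeft_comp,
    reassoc_of% (interchange_yang_baxter X Y Z W), MonoidalCategory.whiskerLeft_comp]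

/-! ### Insertion of a letter into a sorted list -/

variable [LinearOrder S] (c : S → D)

/-- The right-bracketed product of a list of objects, ending with the unit. -/
def listTensor : List S → D
  | [] => 𝟙_ D
  | a :: l => c a ⊗ listTensor l

/-- `IsInsertion c a l l' f` says that `f` is the canonical isomorphism that moves `a` to its place
in the strictly increasing list `l`, thus giving the list `l'`. -/
inductive IsInsertion (a : S) :
    (l l' : List S) → (c a ⊗ listTensor c l ⟶ listTensor c l') → Prop
  | here (l : List S) : (∀ b ∈ l, a < b) → IsInsertion a l (a :: l) (𝟙 _)
  | there (b : S) (l l' : List S) (f : c a ⊗ listTensor c l ⟶ listTensor c l') : b < a →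
      IsInsertion a l l' f →
      IsInsertion a (b :: l) (b :: l') (interchange (c a) (c b) (listTensor c l) ≫ c b ◁ f)

variable {c}

theorem IsInsertion.perm {a : S} {l l' : List S} {f} (h : IsInsertion c a l l' f) :
    l'.Perm (a :: l) := by
  induction h with
  | here l _ => rfl
  | there b l l' f _ _ ih => exact (ih.cons b).trans (.swap a b l)

theorem IsInsertion.isIso {a : S} {l l' : List S} {f} (h : IsInsertion c a l l' f) : IsIso f := by
  induction h with
  | here l _ => exact inferInstanceAs (IsIso (𝟙 (c a ⊗ listTensor c l)))
  | there b l l' f _ _ ih =>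
    have : IsIso (interchange (c a) (c b) (listTensor c l)) :=
      ⟨_, interchange_interchange _ _ _, interchange_interchange _ _ _⟩
    exact inferInstanceAs (IsIso (interchange (c a) (c b) (listTensor c l) ≫ c b ◁ f))

/-- The comparison of `a` with the head decides which constructor applies, so the derivation, and
with it the isomorphism, is forced. -/
theorem IsInsertion.unique {a : S} {l l₁ l₂ : List S} {f g} (h : IsInsertion c a l l₁ f)
    (h' : IsInsertion c a l l₂ g) : l₁ = l₂ ∧ f ≍ g := by
  induction h generalizing l₂ with
  | here l hl =>
    cases h' with
    | here => exact ⟨rfl, HEq.rfl⟩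
    | there b l l' f hb _ => exact absurd hb (hl b List.mem_cons_self).not_gt
  | there b l l' f hb _ ih =>
    cases h' with
    | here _ hl => exact absurd hb (hl b List.mem_cons_self).not_gt
    | there _ _ l'' f' _ h' =>
      obtain ⟨rfl, hf⟩ := ih h'
      obtain rfl := eq_of_heq hf
      exact ⟨rfl, HEq.rfl⟩

/-- Neither constructor covers a head equal to `a`; this is where the absence of repeated letters
enters. -/
theorem exists_isInsertion (a : S) (l : List S) (hl : l.Pairwise (· < ·)) (ha : a ∉ l) :
    ∃ l' f, l'.Pairwise (· < ·) ∧ IsInsertion c a l l' f := by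
  induction l with
  | nil => exact ⟨[a], _, by simp, .here [] (by simp)⟩
  | cons b l ih =>
    rw [List.pairwise_cons] at hl
    rw [List.mem_cons, not_or] at ha
    rcases lt_or_gt_of_ne ha.1 with h | h
    · have hb : ∀ x ∈ b :: l, a < x := by
        intro x hx
        rcases List.mem_cons.1 hx with rfl | hx
        · exact h
        · exact h.trans (hl.1 x hx)
      exact ⟨_, _, List.pairwise_cons.2 ⟨hb, List.pairwise_cons.2 hl⟩, .here _ hb⟩
    · obtain ⟨l', f, hl', hf⟩ := ih hl.2 ha.2
      refine ⟨b :: l', _, List.pairwise_cons.2 ⟨fun x hx => ?_, hl'⟩, .there b l l' f h hf⟩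
      rcases List.mem_cons.1 (hf.perm.mem_iff.1 hx) with rfl | hx
      · exact h
      · exact hl.1 x hx

/-- The order in which two letters are inserted does not matter, up to their interchange. If both
letters pass the head, Yang–Baxter applies; otherwise the claim reduces to unit laws and to the
involutivity of the interchange. -/
theorem IsInsertion.exchange {a b : S} {l l' l'' : List S} {f g} (hf : IsInsertion c a l l' f)
    (hg : IsInsertion c b l' l'' g) : ∃ m f' g', IsInsertion c b l m f' ∧ IsInsertion c a m l'' g' ∧
      c b ◁ f ≫ g = interchange (c b) (c a) (listTensor c l) ≫ c a ◁ f' ≫ g' := by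
  induction hf generalizing l'' with
  | here l hl =>
    cases hg with
    | here _ hb =>
      -- Here `b` comes before `a`. Inserted second, `a` has to pass `b`, and this undoes the
      -- interchange in the claim.
      have hba := hb a List.mem_cons_self
      refine ⟨_, _, _, .here l fun x hx => hba.trans (hl x hx),
        .there b l _ _ hba (.here l hl), ?_⟩
      change c b ◁ 𝟙 _ ≫ 𝟙 _ = _ ≫ c a ◁ 𝟙 _ ≫ interchange (c a) (c b) _ ≫ c b ◁ 𝟙 _
      simp [interchange_interchange]
    | there _ _ m f' hab h' =>
      refine ⟨_, _, _, h', .here m fun x hx => ?_, ?_⟩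
      · rcases List.mem_cons.1 (h'.perm.mem_iff.1 hx) with rfl | hx
        · exact hab
        · exact hl x hx
      · change c b ◁ 𝟙 _ ≫ interchange (c b) (c a) _ ≫ c a ◁ f' =
          interchange (c b) (c a) _ ≫ c a ◁ f' ≫ 𝟙 _
        simp
  | there d l l' f hd hf ih =>
    cases hg with
    | here _ hb =>
      -- Here `b` precedes every letter, so `a` passes it again when inserted second.
      have hl : ∀ x ∈ d :: l, b < x := fun x hx => by
        rcases List.mem_cons.1 hx with rfl | hx
        · exact hb x List.mem_cons_self
        · exact hb x (List.mem_cons_of_mem _ (hf.perm.mem_iff.2 (List.mem_cons_of_mem _ hx)))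
      refine ⟨_, _, _, .here _ hl,
        .there b _ _ _ ((hb d List.mem_cons_self).trans hd) (.there d l l' f hd hf), ?_⟩
      change c b ◁ (interchange (c a) (c d) _ ≫ c d ◁ f) ≫ 𝟙 _ =
        interchange (c b) (c a) (c d ⊗ listTensor c l) ≫ c a ◁ 𝟙 _ ≫ interchange (c a) (c b) _ ≫
          c b ◁ (interchange (c a) (c d) _ ≫ c d ◁ f)
      simp [interchange_interchange_assoc]
    | there _ _ m g' hdb h' =>
      obtain ⟨m₀, f₀, g₀, hf₀, hg₀, e⟩ := ih h'
      exact ⟨_, _, _, .there d l m₀ f₀ hdb hf₀, .there d m₀ m g₀ hd hg₀,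
        interchange_exchange _ _ _ e⟩

/-- The product given by a symmetric monoidal structure. -/
def symmetricStructure (D : Type u) [Category.{v} D] [MonoidalCategory D] [SymmetricCategory D] :
    NonunitalSymmetricMonoidal D where
  tensor := tensor D
  associator := α_
  braiding X Y := β_ X Y
  associator_naturality f g h := associator_naturality f g h
  braiding_naturality f g := BraidedCategory.braiding_naturality f g
  symmetry a b := SymmetricCategory.symmetry a b
  pentagon a b c d := by
    change ((α_ a b c).hom ⊗ₘ 𝟙 d) ≫ _ ≫ (𝟙 a ⊗ₘ (α_ b c d).hom) = _
    simp only [tensorHom_id, id_tensorHom]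
    exact MonoidalCategory.pentagon a b c d
  hexagon a b c := by
    change _ = ((β_ a b).hom ⊗ₘ 𝟙 c) ≫ _ ≫ (𝟙 b ⊗ₘ (β_ a c).hom)
    simp only [tensorHom_id, id_tensorHom]
    exact BraidedCategory.hexagon_forward a b c

/-- The value of a word in a symmetric monoidal category. -/
abbrev wordTensor (c : S → D) (x : Word S) : D := (symmetricStructure D).toProductData.ev c x

/-- The value of a formal composite in a symmetric monoidal category. -/
abbrev formalTensor (c : S → D) {x y : Word S} (p : Word.Formal x y) :
    wordTensor c x ⟶ wordTensor c y :=
  (symmetricStructure D).toProductData.evFormal c p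

/-! ### Sorting the letters of a word -/

variable (c) in
/-- `IsSorting c x l l' f` says that `f` is the canonical isomorphism that moves the letters of `x`
one after the other to their places in the strictly increasing list `l`, thus giving the list
`l'`. -/
def IsSorting : (x : Word S) → (l l' : List S) →
    (wordTensor c x ⊗ listTensor c l ⟶ listTensor c l') → Prop
  | .of a, l, l', f => IsInsertion c a l l' f
  | .mul x y, l, l', f => ∃ m g h, IsSorting y l m g ∧ IsSorting x m l' h ∧
      f = (α_ (wordTensor c x) (wordTensor c y) (listTensor c l)).hom ≫ wordTensor c x ◁ g ≫ h

theorem IsSorting.unique {x : Word S} {l l₁ l₂ : List S} {f g} (h : IsSorting c x l l₁ f)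
    (h' : IsSorting c x l l₂ g) : l₁ = l₂ ∧ f ≍ g := by
  induction x generalizing l l₁ l₂ with
  | of a => exact IsInsertion.unique h h'
  | mul x y hx hy =>
    obtain ⟨m, g, k, hg, hk, rfl⟩ := h
    obtain ⟨m', g', k', hg', hk', rfl⟩ := h'
    obtain ⟨rfl, e⟩ := hy hg hg'
    obtain rfl := eq_of_heq e
    obtain ⟨rfl, e⟩ := hx hk hk'
    obtain rfl := eq_of_heq e
    exact ⟨rfl, HEq.rfl⟩

theorem IsSorting.isIso {x : Word S} {l l' : List S} {f} (h : IsSorting c x l l' f) : IsIso f := by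
  induction x generalizing l l' with
  | of a => exact IsInsertion.isIso h
  | mul x y hx hy =>
    obtain ⟨m, g, k, hg, hk, rfl⟩ := h
    have := hy hg
    have := hx hk
    exact inferInstanceAs (IsIso ((α_ (wordTensor c x) (wordTensor c y) (listTensor c l)).hom ≫
      wordTensor c x ◁ g ≫ k))

theorem exists_isSorting (x : Word S) (l : List S) (hl : l.Pairwise (· < ·))
    (hx : (x.letters ++ l).Nodup) :
    ∃ l' f, l'.Pairwise (· < ·) ∧ l'.Perm (x.letters ++ l) ∧ IsSorting c x l l' f := by
  induction x generalizing l with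
  | of a =>
    obtain ⟨l', f, hl', hf⟩ := exists_isInsertion (c := c) a l hl (List.nodup_cons.1 hx).1
    exact ⟨l', f, hl', hf.perm, hf⟩
  | mul x y hx' hy' =>
    rw [Word.letters, List.append_assoc] at hx
    obtain ⟨m, g, hm, pm, hg⟩ := hy' l hl (List.Nodup.of_append_right hx)
    have p := pm.append_left x.letters
    obtain ⟨l', k, hl', pl, hk⟩ := hx' m hm (p.nodup_iff.2 hx)
    exact ⟨l', _, hl', by rw [Word.letters, List.append_assoc]; exact pl.trans p,
      m, g, k, hg, hk, rfl⟩

/-- Combines the exchange of `Y` with `Z` and that of `X` with `Z` into the exchange of `X ⊗ Y` with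
`Z`, by the hexagon. -/
theorem interchange_exchange_left (X Y Z : D) {W W₁ W₂ W₃ W₄ W₅ : D} {f : Z ⊗ W ⟶ W₁}
    {g : Y ⊗ W₁ ⟶ W₂} {h : X ⊗ W₂ ⟶ W₃} {g' : Y ⊗ W ⟶ W₄} {f' : Z ⊗ W₄ ⟶ W₂}
    {h' : X ⊗ W₄ ⟶ W₅} {f'' : Z ⊗ W₅ ⟶ W₃}
    (e : Y ◁ f ≫ g = interchange Y Z W ≫ Z ◁ g' ≫ f')
    (e' : X ◁ f' ≫ h = interchange X Z W₄ ≫ Z ◁ h' ≫ f'') :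
    (X ⊗ Y) ◁ f ≫ (α_ X Y W₁).hom ≫ X ◁ g ≫ h =
      interchange (X ⊗ Y) Z W ≫ Z ◁ ((α_ X Y W).hom ≫ X ◁ g' ≫ h') ≫ f'' := by
  rw [associator_naturality_right_assoc, ← MonoidalCategory.whiskerLeft_comp_assoc, e]
  simp only [MonoidalCategory.whiskerLeft_comp, Category.assoc, e',
    interchange_naturality_right_assoc]
  rw [reassoc_of% (interchange_tensor_left X Y Z W)]

theorem interchange_exchange_right (X Y Z : D) {W W₁ W₂ W₃ W₄ W₅ : D} {g : Z ⊗ W ⟶ W₁}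
    {h : Y ⊗ W₁ ⟶ W₂} {f : X ⊗ W₂ ⟶ W₃} {f' : X ⊗ W₁ ⟶ W₄} {h' : Y ⊗ W₄ ⟶ W₃}
    {f'' : X ⊗ W ⟶ W₅} {g' : Z ⊗ W₅ ⟶ W₄}
    (e : X ◁ g ≫ f' = interchange X Z W ≫ Z ◁ f'' ≫ g')
    (e' : X ◁ h ≫ f = interchange X Y W₁ ≫ Y ◁ f' ≫ h') :
    X ◁ ((α_ Y Z W).hom ≫ Y ◁ g ≫ h) ≫ f =
      interchange X (Y ⊗ Z) W ≫ (Y ⊗ Z) ◁ f'' ≫ (α_ Y Z W₅).hom ≫ Y ◁ g' ≫ h' := by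
  simp only [MonoidalCategory.whiskerLeft_comp, Category.assoc, e',
    interchange_naturality_right_assoc]
  rw [← MonoidalCategory.whiskerLeft_comp_assoc Y, e]
  simp only [MonoidalCategory.whiskerLeft_comp, Category.assoc]
  rw [reassoc_of% (interchange_tensor_right X Y Z W), associator_naturality_right_assoc]

/-- Once the exchange `e` is inserted, the braiding meets its inverse and cancels by symmetry. -/
theorem braiding_whiskerRight_sorting {X Y L M M' N : D} {g : X ⊗ L ⟶ M} {k : Y ⊗ M ⟶ N}
    {g' : Y ⊗ L ⟶ M'} {k' : X ⊗ M' ⟶ N}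
    (e : Y ◁ g ≫ k = interchange Y X L ≫ X ◁ g' ≫ k') :
    (β_ X Y).hom ▷ L ≫ (α_ Y X L).hom ≫ Y ◁ g ≫ k = (α_ X Y L).hom ≫ X ◁ g' ≫ k' := by
  rw [e]
  simp only [interchange, Category.assoc, Iso.hom_inv_id_assoc]
  rw [← comp_whiskerRight_assoc, SymmetricCategory.symmetry, id_whiskerRight, Category.id_comp]

/-- Double induction on the words down to `IsInsertion.exchange` for two letters; the two hexagons
reassemble products. -/
theorem IsSorting.exchange {x y : Word S} {l l' l'' : List S} {f g} (hf : IsSorting c y l l' f)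
    (hg : IsSorting c x l' l'' g) : ∃ m f' g', IsSorting c x l m f' ∧ IsSorting c y m l'' g' ∧
      wordTensor c x ◁ f ≫ g = interchange (wordTensor c x) (wordTensor c y) (listTensor c l) ≫
        wordTensor c y ◁ f' ≫ g' := by
  induction x generalizing y l l' l'' with
  | of a =>
    induction y generalizing l l' l'' with
    | of b => exact IsInsertion.exchange hf hg
    | mul y z hy hz =>
      obtain ⟨m, k, h, hk, hh, rfl⟩ := hf
      obtain ⟨m₁, f₁, h₁, hf₁, hh₁, e₁⟩ := hy hh hg
      obtain ⟨m₂, f₂, k₂, hf₂, hk₂, e₂⟩ := hz hk hf₁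
      exact ⟨m₂, f₂, _, hf₂, ⟨m₁, k₂, h₁, hk₂, hh₁, rfl⟩, interchange_exchange_right _ _ _ e₂ e₁⟩
  | mul x₁ x₂ h₁ h₂ =>
    obtain ⟨m, k, h, hk, hh, rfl⟩ := hg
    obtain ⟨m₁, k₁, f₁, hk₁, hf₁, e₁⟩ := h₂ hf hk
    obtain ⟨m₂, g₂, f₂, hg₂, hf₂, e₂⟩ := h₁ hf₁ hh
    exact ⟨m₂, _, f₂, ⟨m₁, k₁, g₂, hk₁, hg₂, rfl⟩, hf₂, interchange_exchange_left _ _ _ e₁ e₂⟩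

/-- The core of coherence: each generator carries a sorting of its target to a sorting of its
source. Associators use the pentagon, the braiding uses that `x` and `y` may be sorted in either
order. -/
theorem IsSorting.formal {x y : Word S} (p : Word.Formal x y) {l l' : List S} {f}
    (h : IsSorting c y l l' f) : IsSorting c x l l' (formalTensor c p ▷ listTensor c l ≫ f) := by
  induction p generalizing l l' with
  | id x =>
    convert h using 1
    exact (congrArg (· ≫ f) (id_whiskerRight _ _)).trans (Category.id_comp f)
  | comp p q hp hq =>
    convert hp (hq h) using 1
    exact (congrArg (· ≫ f) (comp_whiskerRight _ _ _)).trans (Category.assoc _ _ _)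
  | mul p q hp hq =>
    obtain ⟨m, g, k, hg, hk, rfl⟩ := h
    exact ⟨m, _, _, hq hg, hp hk, tensorHom_whiskerRight_sorting _ _ _ _⟩
  | assoc x y z =>
    obtain ⟨m, g, k, ⟨m', g', k', hg', hk', rfl⟩, hk, rfl⟩ := h
    exact ⟨m', g', _, hg', ⟨m, k', k, hk', hk, rfl⟩, associator_whiskerRight_sorting _ _ _⟩
  | assocInv x y z =>
    obtain ⟨m, g, k, hg, ⟨m', g', k', hg', hk', rfl⟩, rfl⟩ := h
    exact ⟨m', _, k', ⟨m, g, g', hg, hg', rfl⟩, hk', associator_inv_whiskerRight_sorting _ _ _⟩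
  | braid x y =>
    obtain ⟨m, g, k, hg, hk, rfl⟩ := h
    obtain ⟨m', g', k', hg', hk', e⟩ := hg.exchange hk
    exact ⟨m', g', k', hg', hk', braiding_whiskerRight_sorting e⟩

/-- Two parallel formal composites between words without repeated letters have the same value. -/
theorem formalTensor_eq {x y : Word S} (p q : Word.Formal x y) (hy : y.letters.Nodup) (c : S → D) :
    formalTensor c p = formalTensor c q := by
  -- Sorting starts from the empty list, whose value is the unit object.
  obtain ⟨l, f, _, _, hf⟩ := exists_isSorting (c := c) y [] List.Pairwise.nil (by simpa using hy)
  have := hf.isIso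
  have h := eq_of_heq ((hf.formal p).unique (hf.formal q)).2
  rw [cancel_mono] at h
  -- After cancelling the invertible `f`, the two values agree when tensored with the unit, which is
  -- a faithful operation.
  exact (whiskerRight_iff _ _).1 h

end Coherence

/-! ### Adjoining a unit -/

namespace NonunitalSymmetricMonoidal

variable {C : Type u} [Category.{v} C]

/-- The category `C` together with an isolated new object, which will be the unit of the product
given by `M`. -/
inductive Unitization (M : NonunitalSymmetricMonoidal C) : Type u
  | of : C → Unitization M
  | unit : Unitization M

namespace Unitization

variable {M : NonunitalSymmetricMonoidal C}

/-- Morphisms of the unitization. -/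
def Hom : Unitization M → Unitization M → Type v
  | of X, of Y => X ⟶ Y
  | unit, unit => PUnit
  | _, _ => PEmpty

instance : Category (Unitization M) where
  Hom := Hom
  id
    | of X => 𝟙 X
    | unit => PUnit.unit
  comp {X Y Z} := match X, Y, Z with
    | of _, of _, of _ => fun f g => CategoryStruct.comp (obj := C) f g
    | unit, unit, unit => fun _ _ => PUnit.unit
    | of _, unit, _ => fun f _ => f.elim
    | unit, of _, _ => fun f _ => f.elim
    | of _, of _, unit => fun _ f => f.elim
    | unit, unit, of _ => fun _ f => f.elim
  id_comp {X Y} f := match X, Y, f with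
    | of _, of _, f => Category.id_comp (obj := C) f
    | unit, unit, _ => rfl
  comp_id {X Y} f := match X, Y, f with
    | of _, of _, f => Category.comp_id (obj := C) f
    | unit, unit, _ => rfl
  assoc {X Y Z W} f g h := match X, Y, Z, W, f, g, h with
    | of _, of _, of _, of _, f, g, h => Category.assoc (obj := C) f g h
    | unit, unit, unit, unit, _, _, _ => rfl

/-- The inclusion of `C` in its unitization. -/
def incl (M : NonunitalSymmetricMonoidal C) : C ⥤ Unitization M where
  obj := of
  map f := f

/-- The product of the unitization. -/
def tensorObj : Unitization M → Unitization M → Unitization M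
  | of X, of Y => of (M.tensor.obj (X, Y))
  | of X, unit => of X
  | unit, Y => Y

/-- The product of morphisms of the unitization. -/
def tensorHom : {X Y X' Y' : Unitization M} → (X ⟶ X') → (Y ⟶ Y') →
    (tensorObj X Y ⟶ tensorObj X' Y')
  | of _, of _, of _, of _, f, g => M.tensor.map (Prod.mkHom (C := C) (D := C) f g)
  | of _, unit, of _, unit, f, _ => f
  | unit, _, unit, _, _, g => g

/-- The associativity isomorphism of the unitization. -/
def associator : (X Y Z : Unitization M) →
    (tensorObj (tensorObj X Y) Z ≅ tensorObj X (tensorObj Y Z))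
  | of X, of Y, of Z => (incl M).mapIso (M.associator X Y Z)
  | of _, of _, unit => Iso.refl _
  | of _, unit, _ => Iso.refl _
  | unit, _, _ => Iso.refl _

/-- The commutativity isomorphism of the unitization. -/
def braiding : (X Y : Unitization M) → (tensorObj X Y ≅ tensorObj Y X)
  | of X, of Y => (incl M).mapIso (M.braiding X Y)
  | of _, unit => Iso.refl _
  | unit, of _ => Iso.refl _
  | unit, unit => Iso.refl _

/-- The right unit isomorphism of the unitization. -/
def rightUnitor : (X : Unitization M) → (tensorObj X unit ≅ X)
  | of _ => Iso.refl _
  | unit => Iso.refl _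

instance : MonoidalCategoryStruct (Unitization M) where
  tensorObj := tensorObj
  tensorUnit := unit
  tensorHom := tensorHom
  whiskerLeft X _ _ f := tensorHom (𝟙 X) f
  whiskerRight f X := tensorHom f (𝟙 X)
  associator := associator
  leftUnitor _ := Iso.refl _
  rightUnitor := rightUnitor

/-! ### The symmetric monoidal axioms for the unitization -/

theorem tensor_id (X Y : Unitization M) : tensorHom (𝟙 X) (𝟙 Y) = 𝟙 (tensorObj X Y) :=
  match X, Y with
  | of X, of Y => M.tensor.map_id (X, Y)
  | of _, unit => rfl
  | unit, of _ => rfl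
  | unit, unit => rfl

theorem tensor_comp {X X' X'' Y Y' Y'' : Unitization M} (f : X ⟶ X') (g : Y ⟶ Y') (f' : X' ⟶ X'')
    (g' : Y' ⟶ Y'') : tensorHom (f ≫ f') (g ≫ g') = tensorHom f g ≫ tensorHom f' g' :=
  match X, X', X'', Y, Y', Y'', f, g, f', g' with
  | of _, of _, of _, of _, of _, of _, f, g, f', g' =>
    M.tensor.map_comp (Prod.mkHom (C := C) (D := C) f g) (Prod.mkHom (C := C) (D := C) f' g')
  | of _, of _, of _, unit, unit, unit, _, _, _, _ => rfl
  | unit, unit, unit, of _, of _, of _, _, _, _, _ => rfl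
  | unit, unit, unit, unit, unit, unit, _, _, _, _ => rfl

theorem associator_naturality {X X' Y Y' Z Z' : Unitization M} (f : X ⟶ X') (g : Y ⟶ Y')
    (h : Z ⟶ Z') : tensorHom (tensorHom f g) h ≫ (associator X' Y' Z').hom =
      (associator X Y Z).hom ≫ tensorHom f (tensorHom g h) := by
  rcases X with X | _ <;> rcases X' with X' | _ <;> (try exact f.elim) <;>
  rcases Y with Y | _ <;> rcases Y' with Y' | _ <;> (try exact g.elim) <;>
  rcases Z with Z | _ <;> rcases Z' with Z' | _ <;> (try exact h.elim)
  · exact M.associator_naturality (C := C) f g h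
  all_goals exact (Category.comp_id _).trans (Category.id_comp _).symm

theorem pentagon (X Y Z W : Unitization M) :
    tensorHom (associator X Y Z).hom (𝟙 W) ≫ (associator X (tensorObj Y Z) W).hom ≫
        tensorHom (𝟙 X) (associator Y Z W).hom =
      (associator (tensorObj X Y) Z W).hom ≫ (associator X Y (tensorObj Z W)).hom := by
  -- If some object is the unit, at most one associator survives on each side. The four auxiliary
  -- statements differ in where it stands.
  have h₁ {P Q : Unitization M} {a : P ⟶ P} (ha : a = 𝟙 P) (f : P ⟶ Q) :
      a ≫ 𝟙 P ≫ f = f ≫ 𝟙 Q := by simp [ha]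
  have h₂ {P Q : Unitization M} {a : P ⟶ P} {b : Q ⟶ Q} (ha : a = 𝟙 P) (hb : b = 𝟙 Q)
      (f : P ⟶ Q) : a ≫ f ≫ b = f ≫ 𝟙 Q := by simp [ha, hb]
  have h₃ {P Q : Unitization M} {a : P ⟶ P} {b : Q ⟶ Q} (ha : a = 𝟙 P) (hb : b = 𝟙 Q)
      (f : P ⟶ Q) : a ≫ f ≫ b = 𝟙 P ≫ f := by simp [ha, hb]
  have h₄ {P Q : Unitization M} {b : Q ⟶ Q} (hb : b = 𝟙 Q) (f : P ⟶ Q) :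
      f ≫ 𝟙 Q ≫ b = 𝟙 P ≫ f := by simp [hb]
  rcases X with X | _ <;> rcases Y with Y | _ <;> rcases Z with Z | _ <;> rcases W with W | _
  · exact M.pentagon X Y Z W
  · exact h₄ (tensor_id (of _) (of _)) (associator (of X) (of Y) (of Z)).hom
  · exact h₃ (tensor_id (of _) (of _)) (tensor_id (of _) (of _)) (associator (of X) (of Y) (of W)).hom
  · exact h₂ (tensor_id (of _) unit) (tensor_id (of X) (of Y)) (𝟙 _)
  · exact h₂ (tensor_id (of _) (of _)) (tensor_id (of _) (of _)) (associator (of X) (of Z) (of W)).hom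
  · exact h₂ (tensor_id (of _) unit) (tensor_id (of X) (of Z)) (𝟙 _)
  · exact h₂ (tensor_id (of _) (of _)) (tensor_id (of _) (of _)) (𝟙 _)
  · exact h₂ (tensor_id _ _) (tensor_id _ _) (𝟙 _)
  · exact h₁ (tensor_id (of _) (of _)) (associator (of Y) (of Z) (of W)).hom
  · exact h₂ (tensor_id (of _) unit) (tensor_id unit (of (M.tensor.obj (Y, Z)))) (𝟙 _)
  · exact h₂ (tensor_id (of Y) (of W)) (tensor_id unit (of _)) (𝟙 _)
  · exact h₂ (tensor_id _ _) (tensor_id _ _) (𝟙 _)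
  · exact h₂ (tensor_id (of Z) (of W)) (tensor_id unit (of _)) (𝟙 _)
  all_goals exact h₂ (tensor_id _ _) (tensor_id _ _) (𝟙 _)

theorem hexagon (X Y Z : Unitization M) :
    (associator X Y Z).hom ≫ (braiding X (tensorObj Y Z)).hom ≫ (associator Y Z X).hom =
      tensorHom (braiding X Y).hom (𝟙 Z) ≫ (associator Y X Z).hom ≫
        tensorHom (𝟙 Y) (braiding X Z).hom := by
  -- With a unit present all associators are identities, and at most one braiding survives on each
  -- side.
  have h₁ {P Q : Unitization M} {a : P ⟶ P} (ha : a = 𝟙 P) (f : P ⟶ Q) :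
      𝟙 P ≫ f ≫ 𝟙 Q = a ≫ 𝟙 P ≫ f := by simp [ha]
  have h₂ {P Q : Unitization M} {b : Q ⟶ Q} (hb : b = 𝟙 Q) (f : P ⟶ Q) :
      𝟙 P ≫ f ≫ 𝟙 Q = f ≫ 𝟙 Q ≫ b := by simp [hb]
  have h₃ {P : Unitization M} {a b : P ⟶ P} (ha : a = 𝟙 P) (hb : b = 𝟙 P) :
      𝟙 P ≫ 𝟙 P ≫ 𝟙 P = a ≫ 𝟙 P ≫ b := by simp [ha, hb]
  rcases X with X | _ <;> rcases Y with Y | _ <;> rcases Z with Z | _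
  · exact M.hexagon X Y Z
  · exact h₂ (tensor_id (of Y) (of X)) (braiding (of X) (of Y)).hom
  · exact h₁ (tensor_id (of _) (of _)) (braiding (of X) (of Z)).hom
  all_goals exact h₃ (tensor_id _ _) (tensor_id _ _)

theorem braiding_symmetry (X Y : Unitization M) :
    (braiding X Y).hom ≫ (braiding Y X).hom = 𝟙 (tensorObj X Y) :=
  match X, Y with
  | of X, of Y => M.symmetry X Y
  | of _, unit => Category.id_comp _
  | unit, of _ => Category.id_comp _
  | unit, unit => Category.id_comp _

theorem braiding_naturality {X X' Y Y' : Unitization M} (f : X ⟶ X') (g : Y ⟶ Y') :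
    tensorHom f g ≫ (braiding X' Y').hom = (braiding X Y).hom ≫ tensorHom g f := by
  rcases X with X | _ <;> rcases X' with X' | _ <;> (try exact f.elim) <;>
  rcases Y with Y | _ <;> rcases Y' with Y' | _ <;> (try exact g.elim)
  · exact M.braiding_naturality (C := C) f g
  all_goals exact (Category.comp_id _).trans (Category.id_comp _).symm

instance : MonoidalCategory (Unitization M) :=
  MonoidalCategory.ofTensorHom
    (id_tensorHom_id := tensor_id)
    (id_tensorHom := fun _ _ _ _ => rfl)
    (tensorHom_id := fun _ _ => rfl)
    (tensorHom_comp_tensorHom := fun f g f' g' => (tensor_comp f g f' g').symm)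
    (associator_naturality := associator_naturality)
    (leftUnitor_naturality := fun _ => (Category.comp_id _).trans (Category.id_comp _).symm)
    (rightUnitor_naturality := fun {X Y} f => by
      rcases X with X | _ <;> rcases Y with Y | _ <;> (try exact f.elim) <;>
      exact (Category.comp_id _).trans (Category.id_comp _).symm)
    (pentagon := pentagon)
    (triangle := fun X Y => by
      rcases X with X | _ <;> rcases Y with Y | _ <;> exact Category.id_comp _)

instance : SymmetricCategory (Unitization M) where
  braiding := braiding
  braiding_naturality_right X _ _ f := braiding_naturality (𝟙 X) f
  braiding_naturality_left f X := braiding_naturality f (𝟙 X)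
  hexagon_forward := hexagon
  hexagon_reverse X Y Z := by
    have h (X Y : Unitization M) : (braiding X Y).inv = (braiding Y X).hom :=
      (Iso.inv_ext' (braiding_symmetry X Y)).symm
    -- The reverse hexagon is the inverse of the forward one at `Z`, `X`, `Y`, since by symmetry
    -- inverse braidings are braidings.
    have e : MonoidalCategoryStruct.associator Z X Y ≪≫ braiding Z (tensorObj X Y) ≪≫
        MonoidalCategoryStruct.associator X Y Z =
      MonoidalCategory.whiskerRightIso (braiding Z X) Y ≪≫
        MonoidalCategoryStruct.associator X Z Y ≪≫
        MonoidalCategory.whiskerLeftIso X (braiding Z Y) := Iso.ext (hexagon Z X Y)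
    have := congrArg Iso.inv e
    simp only [Iso.trans_inv, MonoidalCategory.whiskerRightIso_inv,
      MonoidalCategory.whiskerLeftIso_inv, h, Category.assoc] at this
    exact this
  symmetry := braiding_symmetry

theorem isStrict_incl : M.toProductData.IsStrict
    (symmetricStructure (Unitization M)).toProductData (incl M) where
  map_tensor := rfl
  map_associator _ _ _ := rfl
  map_braiding _ _ := rfl

end Unitization

/-- Two parallel formal composites between words without repeated letters have the same value. -/
theorem evFormal_eq (M : NonunitalSymmetricMonoidal C) {S : Type w} [LinearOrder S] (c : S → C)
    {x y : Word S} (p q : Word.Formal x y) (hy : y.letters.Nodup) :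
    M.toProductData.evFormal c p = M.toProductData.evFormal c q :=
  -- The inclusion is the identity on morphisms, so an equality of images is already the desired
  -- equality.
  arrow_injective (C := Unitization M) <|
    (Unitization.isStrict_incl.evFormal c p).trans <|
      (congrArg Arrow.mk (formalTensor_eq p q hy _)).trans
        (Unitization.isStrict_incl.evFormal c q).symm

end NonunitalSymmetricMonoidal

/-! ### The word of an object of `ELV` -/

namespace Word

variable {S : Type w} {S' S'' : Type*}

/-- The parenthesization underlying a word. -/
def shape : Word S → Paren
  | of _ => .one
  | mul x y => .pair x.shape y.shape

theorem rename_rename (g : S → S') (g' : S' → S'') (x : Word S) :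
    (x.rename g).rename g' = x.rename fun s => g' (g s) :=
  subst_subst _ _ x

theorem rename_id (x : Word S) : x.rename (fun s => s) = x := by
  induction x with
  | of a => rfl
  | mul x y hx hy => simp only [rename, subst] at *; rw [hx, hy]

end Word

namespace Paren

variable {S : Type w} {S' : Type*}

/-- The word with a given parenthesization and with given letters. -/
def label : (t : Paren) → (Fin t.deg → S) → Word S
  | one, l => .of (l ⟨0, Nat.one_pos⟩)
  | pair s t, l => .mul (s.label fun i => l (Fin.castAdd t.deg i))
      (t.label fun i => l (Fin.natAdd s.deg i))

/-- Labelling by an infinite sequence, of which only the first `deg t` terms are used. -/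
def labelSeq : Paren → (ℕ → S) → Word S
  | one, l => .of (l 0)
  | pair s t, l => .mul (s.labelSeq l) (t.labelSeq fun i => l (s.deg + i))

theorem label_eq (t : Paren) (l : Fin t.deg → S) (L : ℕ → S) (h : ∀ i : Fin t.deg, L i = l i) :
    t.label l = t.labelSeq L := by
  induction t generalizing L with
  | one => exact congrArg Word.of (h _).symm
  | pair s t ihs iht =>
    simp only [label, labelSeq]
    rw [ihs _ L fun i => h (Fin.castAdd _ i),
      iht _ (fun i => L (s.deg + i)) fun i => h (Fin.natAdd _ i)]

theorem deg_pos (t : Paren) : 0 < t.deg := by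
  induction t with
  | one => exact Nat.one_pos
  | pair s t hs _ => exact Nat.add_pos_left hs _

theorem letters_label (t : Paren) (l : Fin t.deg → S) : (t.label l).letters = List.ofFn l := by
  induction t with
  | one => exact (List.ofFn_succ (f := l)).symm
  | pair s t hs ht => exact (congrArg₂ _ (hs _) (ht _)).trans List.ofFn_add.symm

theorem shape_label (t : Paren) (l : Fin t.deg → S) : (t.label l).shape = t := by
  induction t with
  | one => rfl
  | pair s t hs ht => exact congrArg₂ _ (hs _) (ht _)

theorem rename_label (t : Paren) (l : Fin t.deg → S) (g : S → S') :
    (t.label l).rename g = t.label fun i => g (l i) := by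
  induction t with
  | one => rfl
  | pair s t hs ht => exact congrArg₂ _ (hs _) (ht _)

theorem subst_labelSeq_congr (t : Paren) {S'' : Type*} (L : ℕ → S) (L' : ℕ → S'')
    (g : S → Word S') (g' : S'' → Word S') (h : ∀ i < t.deg, g (L i) = g' (L' i)) :
    (t.labelSeq L).subst g = (t.labelSeq L').subst g' := by
  induction t generalizing L L' with
  | one => exact h 0 Nat.one_pos
  | pair s t hs ht =>
    exact congrArg₂ _ (hs _ _ fun i hi => h i (hi.trans_le (Nat.le_add_right _ _)))
      (ht _ _ fun i hi => h _ (Nat.add_lt_add_left hi _))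

/-- The leaves of the i-th grafted tree stand after all leaves of the earlier ones, whence the
offset. Infinite sequences avoid casts between finite index types. -/
theorem labelSeq_graftSeq (t : Paren) (A : ℕ → Paren) (L : ℕ → S) :
    (t.graftSeq A).labelSeq L = (t.labelSeq fun i => i).subst fun i =>
      (A i).labelSeq fun j => L (∑ x ∈ Finset.range i, (A x).deg + j) := by
  induction t generalizing A L with
  | one => simp [graftSeq, labelSeq, Word.subst]
  | pair s t hs ht =>
    simp only [graftSeq, labelSeq, Word.subst, hs, ht, deg_graftSeq]
    congr 1
    refine subst_labelSeq_congr t _ _ _ _ fun i _ => ?_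
    simp only [Finset.sum_range_add, add_assoc]

end Paren

namespace ELV

/-- The parenthesization of an object of `ELV`. -/
def paren {n : ℕ} (x : ELV.obj n) : V n := (Codiscrete.as (α := V n × Equiv.Perm (Fin n)) x).1

/-- The permutation of an object of `ELV`. -/
def perm {n : ℕ} (x : ELV.obj n) : Equiv.Perm (Fin n) :=
  (Codiscrete.as (α := V n × Equiv.Perm (Fin n)) x).2

theorem ext {n : ℕ} {x y : ELV.obj n} (h : (paren x).1 = (paren y).1) (h' : perm x = perm y) :
    x = y :=
  congrArg (Codiscrete.mk (α := V n × Equiv.Perm (Fin n))) (Prod.ext (Subtype.ext h) h')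

/-- The word in the letters `0, …, n-1` given by an object of `ELV (n)`. -/
def word {n : ℕ} (x : ELV.obj n) : Word (Fin n) :=
  -- The inverse makes position i carry letter σ⁻¹ i, matching the permuted list in the equivariance
  -- axiom.
  (paren x).1.label fun i => (perm x)⁻¹ (Fin.cast (paren x).2 i)

theorem rename_word {S : Type w} {n : ℕ} (x : ELV.obj n) (l : Fin n → S) :
    (word x).rename l = (paren x).1.label fun i => l ((perm x)⁻¹ (Fin.cast (paren x).2 i)) :=
  Paren.rename_label _ _ _

theorem letters_rename_word {S : Type w} {n : ℕ} (x : ELV.obj n) (l : Fin n → S) :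
    ((word x).rename l).letters = List.ofFn fun i => l ((perm x)⁻¹ i) := by
  rw [rename_word, Paren.letters_label]
  exact (List.ofFn_congr (paren x).2.symm fun i => l ((perm x)⁻¹ i)).symm

theorem letters_word {n : ℕ} (x : ELV.obj n) :
    (word x).letters = List.ofFn fun i => (perm x)⁻¹ i := by
  rw [← Word.rename_id (word x), letters_rename_word]

theorem nodup_letters_word {n : ℕ} (x : ELV.obj n) : (word x).letters.Nodup := by
  rw [letters_word, List.nodup_ofFn]
  exact (perm x)⁻¹.injective

theorem perm_letters_word {n : ℕ} (x y : ELV.obj n) :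
    (word x).letters.Perm (word y).letters := by
  refine (List.perm_ext_iff_of_nodup (nodup_letters_word x) (nodup_letters_word y)).2 fun i => ?_
  rw [letters_word, letters_word, List.mem_ofFn, List.mem_ofFn]
  exact iff_of_true ((perm x)⁻¹.surjective i) ((perm y)⁻¹.surjective i)

theorem word_act {n : ℕ} (σ : Equiv.Perm (Fin n)) (x : ELV.obj n) :
    word ((ELV.act σ).obj x) = (word x).rename ⇑(σ⁻¹) := by
  rw [rename_word]
  change Paren.label _ (fun i => (perm x * σ)⁻¹ _) = _
  simp only [mul_inv_rev]
  rfl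

/-- Grafting is substitution of shapes. On letters, the inverse of the composite permutation sends
the i-th target block to the block σ⁻¹ i of the source, as `perm_inv_apply` says. -/
theorem word_comp {n m : ℕ} (k : Fin n → ℕ) (h : ∑ i, k i = m) (x : ELV.obj n)
    (y : ∀ i, ELV.obj (k i)) :
    word ((ELV.comp k h).obj (x, y)) =
      (word x).subst fun i => (word (y i)).rename fun j => blockEquiv k h ⟨i, j⟩ := by
  -- Extending families on `Fin n` and `Fin m` to sequences requires default elements; they exist
  -- because every parenthesization has a leaf.
  have hn : 0 < n := by rw [← (paren x).2]; exact Paren.deg_pos _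
  have hm : 0 < m := by rw [← (paren ((ELV.comp k h).obj (x, y))).2]; exact Paren.deg_pos _
  obtain ⟨A, hA⟩ := exists_ext Paren.one fun i : Fin n => (paren (y ((perm x)⁻¹ i))).1
  obtain ⟨B, hB⟩ := exists_ext (⟨0, hm⟩ : Fin m) fun s => (perm ((ELV.comp k h).obj (x, y)))⁻¹ s
  obtain ⟨E, hE⟩ := exists_ext (⟨0, hn⟩ : Fin n) fun i => (perm x)⁻¹ i
  have e₁ : word ((ELV.comp k h).obj (x, y)) = ((paren x).1.graftSeq A).labelSeq B := by
    rw [← V.comp_val (fun i => k ((perm x)⁻¹ i)) (sum_perm _ h) (paren x)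
      (fun i => paren (y ((perm x)⁻¹ i))) A hA]
    exact Paren.label_eq _ _ _ fun i => hB (Fin.cast (paren ((ELV.comp k h).obj (x, y))).2 i)
  have e₂ : word x = (paren x).1.labelSeq E :=
    Paren.label_eq _ _ _ fun i => hE (Fin.cast (paren x).2 i)
  rw [e₁, e₂, Paren.labelSeq_graftSeq]
  refine Paren.subst_labelSeq_congr _ _ _ _ _ fun i hi => ?_
  rw [(paren x).2] at hi
  rw [hE ⟨i, hi⟩, rename_word, hA ⟨i, hi⟩]
  refine (Paren.label_eq _ _ _ fun j => ?_).symm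
  have hv := blockEquiv_val (fun i => k ((perm x)⁻¹ i)) (sum_perm _ h) (fun x => (A x).deg)
    (fun i => by rw [hA i]; exact (paren (y ((perm x)⁻¹ i))).2) ⟨i, hi⟩
    (Fin.cast (paren (y ((perm x)⁻¹ ⟨i, hi⟩))).2 j)
  refine (congrArg B hv.symm).trans ((hB _).trans ?_)
  exact perm_inv_apply (perm x) k h (fun i => perm (y i)) ⟨i, hi⟩ _

/-- Objects of `ELV` that give the same word up to renaming differ by a permutation. -/
theorem exists_act_of_rename_eq {S : Type w} {n : ℕ} {x x' : ELV.obj n} {l l' : Fin n → S}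
    (h : (word x).rename l = (word x').rename l') :
    ∃ σ : Equiv.Perm (Fin n), x' = (ELV.act σ).obj x ∧ l' = fun i => l (σ i) := by
  have e := congrArg Word.shape h
  have e' := congrArg Word.letters h
  rw [rename_word, rename_word, Paren.shape_label, Paren.shape_label] at e
  rw [letters_rename_word, letters_rename_word] at e'
  refine ⟨(perm x)⁻¹ * perm x', ext e.symm ?_, ?_⟩
  · exact (mul_inv_cancel_left (perm x) (perm x')).symm
  · funext i
    have := congrFun (List.ofFn_injective e') (perm x' i)
    simpa using this.symm

theorem eq_of_rename_eq {S : Type w} {n n' : ℕ} {x : ELV.obj n} {x' : ELV.obj n'}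
    {l : Fin n → S} {l' : Fin n' → S} (h : (word x).rename l = (word x').rename l') : n = n' := by
  have := congrArg (fun w => w.letters.length) h
  simpa only [letters_rename_word, List.length_ofFn] using this

/-- A formal composite between the words of two objects of `ELV`. -/
noncomputable def formal {n : ℕ} (x y : ELV.obj n) : Word.Formal (word x) (word y) :=
  (Word.nonempty_formal (perm_letters_word x y)).some

end ELV

/-! ### The `ELV`-algebra of a non-unital symmetric monoidal structure -/

theorem ProductData.arrow_evMap {C : Type u} [Category.{v} C] (M : ProductData C) {S : Type w}
    {c c' : S → C} (f : c ⟶ c') {x x' : Word S} (h : x = x') :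
    Arrow.mk (M.evMap f x) = Arrow.mk (M.evMap f x') := by rw [h]

namespace NonunitalSymmetricMonoidal

variable {C : Type u} [Category.{v} C] (M : NonunitalSymmetricMonoidal C)

theorem arrow_evFormal {S : Type w} [LinearOrder S] (c : S → C) {x y x' y' : Word S}
    (hx : x = x') (hy : y = y') (p : Word.Formal x y) (q : Word.Formal x' y')
    (h : y.letters.Nodup) :
    Arrow.mk (M.toProductData.evFormal c p) = Arrow.mk (M.toProductData.evFormal c q) := by
  subst hx hy
  rw [M.evFormal_eq c p q h]

/-- The action of `ELV (n)` given by evaluating words. -/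
noncomputable def wordAction (n : ℕ) : ELV.obj n × (Fin n → C) ⥤ C where
  obj p := M.toProductData.ev p.2 (ELV.word p.1)
  map {p q} φ := M.toProductData.evMap φ.2 (ELV.word p.1) ≫
    M.toProductData.evFormal q.2 (ELV.formal p.1 q.1)
  map_id p := by
    -- By coherence the arbitrarily chosen formal composite may be replaced by any convenient one.
    rw [M.evFormal_eq p.2 (ELV.formal p.1 p.1) (.id _) (ELV.nodup_letters_word _)]
    exact (congrArg (· ≫ _) (M.toProductData.evMap_id _ _)).trans (Category.id_comp _)
  map_comp {p q r} φ ψ := by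
    rw [M.evFormal_eq r.2 (ELV.formal p.1 r.1) (.comp (ELV.formal p.1 q.1) (ELV.formal q.1 r.1))
      (ELV.nodup_letters_word _)]
    have e := M.toProductData.evMap_comp φ.2 ψ.2 (ELV.word p.1)
    have e' := M.evFormal_naturality ψ.2 (ELV.formal p.1 q.1)
    change M.toProductData.evMap (φ.2 ≫ ψ.2) _ ≫ (_ ≫ _) = _
    rw [e, Category.assoc, Category.assoc, reassoc_of% e']

/-- The `ELV`-algebra structure given by evaluating words. -/
noncomputable def toAlgebra : ELV.Algebra C where
  act := M.wordAction
  one_act := functor_eq_of_arrow fun {X Y} f => by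
    change Arrow.mk (f ≫ M.toProductData.evFormal (fun _ => Y) (ELV.formal ELV.one ELV.one)) = _
    rw [M.evFormal_eq _ (ELV.formal ELV.one ELV.one) (.id _) (ELV.nodup_letters_word _)]
    exact congrArg Arrow.mk (Category.comp_id f)
  comp_act k h := functor_eq_of_arrow fun {p q} φ => by
    have hx := ELV.word_comp k h p.1.1 p.1.2
    have hy := ELV.word_comp k h q.1.1 q.1.2
    let c i := fun j => p.2 (blockEquiv k h ⟨i, j⟩)
    let c' i := fun j => q.2 (blockEquiv k h ⟨i, j⟩)
    let f i : c i ⟶ c' i := fun j => φ.2 (blockEquiv k h ⟨i, j⟩)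
    let b i j : Word _ := .of (blockEquiv k h ⟨i, j⟩)
    let r i := (ELV.formal (p.1.2 i) (q.1.2 i)).subst (b i)
    let F i := M.toProductData.evMap (f i) (ELV.word (p.1.2 i))
    let G i := M.toProductData.evFormal (c' i) (ELV.formal (p.1.2 i) (q.1.2 i))
    -- The functorial part: evaluating the substituted word means evaluating the inner words first.
    have e := (M.toProductData.arrow_evMap φ.2 hx).trans
      ((M.toProductData.evMap_subst _ φ.2 (ELV.word p.1.1)).trans
        (M.toProductData.arrow_ev (g := F)
          (fun i => M.toProductData.evMap_subst _ φ.2 (ELV.word (p.1.2 i))) (ELV.word p.1.1)))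
    have e₁ := (M.toProductData.evFormal_substMap r q.2 (ELV.word p.1.1)).trans
      (M.toProductData.arrow_ev (g := G)
        (fun i => M.toProductData.evFormal_subst _ q.2 _) (ELV.word p.1.1))
    have e₂ := (M.toProductData.evFormal_subst _ q.2 (ELV.formal p.1.1 q.1.1)).trans
      (congrArg (fun c => Arrow.mk (M.toProductData.evFormal c (ELV.formal p.1.1 q.1.1)))
        (funext fun i => M.toProductData.ev_subst (b i) q.2 (ELV.word (q.1.2 i))))
    -- The coherence part: the chosen composite is replaced by the inner composites followed by the
    -- outer one.
    have e' := (M.arrow_evFormal q.2 hx hy (ELV.formal _ _)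
      (.comp (.substMap r (ELV.word p.1.1)) ((ELV.formal p.1.1 q.1.1).subst _))
      (ELV.nodup_letters_word _)).trans (arrow_comp e₁ e₂)
    have e'' := (congrArg (· ≫ M.toProductData.evFormal _ (ELV.formal p.1.1 q.1.1))
      (M.toProductData.evMap_comp F G (ELV.word p.1.1))).trans (Category.assoc _ _ _)
    exact (arrow_comp e e').trans (congrArg Arrow.mk e''.symm)
  perm_act σ := functor_eq_of_arrow fun {p q} φ => by
    have hx := ELV.word_act σ p.1
    have hy := ELV.word_act σ q.1
    exact arrow_comp ((M.toProductData.arrow_evMap φ.2 hx).trans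
        (M.toProductData.evMap_subst _ φ.2 (ELV.word p.1)))
      ((M.arrow_evFormal q.2 hx hy (ELV.formal _ _) ((ELV.formal p.1 q.1).subst _)
        (ELV.nodup_letters_word _)).trans (M.toProductData.evFormal_subst _ _ _))

end NonunitalSymmetricMonoidal

/-! ### The non-unital symmetric monoidal structure of an `ELV`-algebra -/

namespace ELV

open Paren in
/-- The parenthesization `(1,1)`. -/
def mul : ELV.obj 2 := ELV.mk 2 (pair one one) rfl 1

open Paren in
/-- The parenthesization `(1,1)` with the transposition. -/
def mulSwap : ELV.obj 2 := ELV.mk 2 (pair one one) rfl (Equiv.swap 0 1)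

open Paren in
/-- The parenthesization `((1,1),1)`. -/
def mulLeft : ELV.obj 3 := ELV.mk 3 (pair (pair one one) one) rfl 1

open Paren in
/-- The parenthesization `(1,(1,1))`. -/
def mulRight : ELV.obj 3 := ELV.mk 3 (pair one (pair one one)) rfl 1

theorem exists_act_eq {n : ℕ} (σ : Equiv.Perm (Fin n)) (x : ELV.obj n) :
    ∃ y : ELV.obj n, (ELV.act σ).obj y = x :=
  ⟨(ELV.act σ⁻¹).obj x, ext rfl (inv_mul_cancel_right (perm x) σ)⟩

end ELV

namespace ELVAlgebra

variable {C : Type u} [Category.{v} C] (A : ELV.Algebra C)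

/-- The image of the unique morphism `x ⟶ y` and of `f` under the action. -/
def arr {n : ℕ} (x y : ELV.obj n) {c c' : Fin n → C} (f : c ⟶ c') : Arrow C :=
  Arrow.mk ((A.act n).map (Prod.mkHom (ELV.hom x y) f))

theorem arr_one {X Y : C} (f : X ⟶ Y) :
    arr A ELV.one ELV.one (c := fun _ => X) (c' := fun _ => Y) (fun _ => f) = Arrow.mk f :=
  arrow_of_functor_eq A.one_act f

theorem arr_act {n : ℕ} (σ : Equiv.Perm (Fin n)) (x y : ELV.obj n) {c c' : Fin n → C} (f : c ⟶ c') :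
    arr A ((ELV.act σ).obj x) ((ELV.act σ).obj y) f =
      arr A x y (c := fun i => c (σ⁻¹ i)) (c' := fun i => c' (σ⁻¹ i)) (fun i => f (σ⁻¹ i)) :=
  arrow_of_functor_eq (A.perm_act σ) (X := (x, c)) (Y := (y, c')) (Prod.mkHom (ELV.hom x y) f)

theorem arr_congr {n : ℕ} (x y : ELV.obj n) {c c' d d' : Fin n → C} {f : c ⟶ c'} {g : d ⟶ d'}
    (h : ∀ i, Arrow.mk (f i) = Arrow.mk (g i)) : arr A x y f = arr A x y g := by
  have := arrow_pi h
  cases this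
  rfl

/-- The associativity axiom, with the inner results `g` prescribed only up to equality of arrows. -/
theorem arr_comp {n m : ℕ} (k : Fin n → ℕ) (h : ∑ i, k i = m) (x x' : ELV.obj n)
    (y y' : ∀ i, ELV.obj (k i)) {c c' : Fin m → C} (f : c ⟶ c') {d d' : Fin n → C} (g : d ⟶ d')
    (hg : ∀ i, Arrow.mk (g i) = arr A (y i) (y' i) (c := fun j => c (blockEquiv k h ⟨i, j⟩))
      (c' := fun j => c' (blockEquiv k h ⟨i, j⟩)) (fun j => f (blockEquiv k h ⟨i, j⟩))) :
    arr A ((ELV.comp k h).obj (x, y)) ((ELV.comp k h).obj (x', y')) f = arr A x x' g :=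
  (arrow_of_functor_eq (A.comp_act k h) (X := ((x, y), c)) (Y := ((x', y'), c'))
    (Prod.mkHom (Prod.mkHom (ELV.hom x x') fun i => ELV.hom (y i) (y' i)) f)).trans
    (arr_congr A x x' fun i => (hg i).symm)

/-- Functoriality: the unique morphisms `x ⟶ y` and `y ⟶ z` compose to the unique morphism `x ⟶ z`.
-/
theorem arr_trans {n : ℕ} {x y z : ELV.obj n} {c c' c'' : Fin n → C} {f : c ⟶ c'} {g : c' ⟶ c''}
    {X Y Z : C} {u : X ⟶ Y} {v : Y ⟶ Z} (hu : Arrow.mk u = arr A x y f)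
    (hv : Arrow.mk v = arr A y z g) : Arrow.mk (u ≫ v) = arr A x z (f ≫ g) := by
  refine (arrow_comp hu hv).trans (congrArg Arrow.mk ?_)
  rw [← Functor.map_comp]
  rfl

theorem arr_comp_id {n : ℕ} {x y z : ELV.obj n} {c c' : Fin n → C} {f : c ⟶ c'} {X Y Z : C}
    {u : X ⟶ Y} {v : Y ⟶ Z} (hu : Arrow.mk u = arr A x y f) (hv : Arrow.mk v = arr A y z (𝟙 c')) :
    Arrow.mk (u ≫ v) = arr A x z f :=
  (arr_trans A hu hv).trans (by rw [Category.comp_id])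

theorem arr_id_comp {n : ℕ} {x y z : ELV.obj n} {c c' : Fin n → C} {f : c ⟶ c'} {X Y Z : C}
    {u : X ⟶ Y} {v : Y ⟶ Z} (hu : Arrow.mk u = arr A x y (𝟙 c)) (hv : Arrow.mk v = arr A y z f) :
    Arrow.mk (u ≫ v) = arr A x z f :=
  (arr_trans A hu hv).trans (by rw [Category.id_comp])

/-- The product of the structure given by `A`. -/
def tensor : C × C ⥤ C := pairFunctor C ⋙ Prod.sectR ELV.mul (Fin 2 → C) ⋙ A.act 2

/-! ### Arrows realized by morphisms of `ELV` -/

variable {S : Type w}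

/-- `Realizes A f w w' a` says that, for some morphism of `ELV` that becomes a morphism from `w` to
`w'` after renaming the letters, the arrow `a` is the image of this morphism and of `f`. -/
def Realizes {c c' : S → C} (f : c ⟶ c') (w w' : Word S) (a : Arrow C) : Prop :=
  ∃ (n : ℕ) (x y : ELV.obj n) (l : Fin n → S), (ELV.word x).rename l = w ∧
    (ELV.word y).rename l = w' ∧
    a = arr A x y (c := fun i => c (l i)) (c' := fun i => c' (l i)) (fun i => f (l i))

variable {A}

theorem Realizes.of {c c' : S → C} (f : c ⟶ c') (s : S) :
    Realizes A f (.of s) (.of s) (Arrow.mk (f s)) :=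
  ⟨1, ELV.one, ELV.one, fun _ => s, rfl, rfl, (arr_one A (f s)).symm⟩

/-- The operadic composites realize the result. Their letters are those of the inner objects, listed
block after block by `L`. -/
theorem Realizes.act {c c' : S → C} {f : c ⟶ c'} {n : ℕ} (x y : ELV.obj n) {w w' : Fin n → Word S}
    {d d' : Fin n → C} (g : d ⟶ d') (h : ∀ i, Realizes A f (w i) (w' i) (Arrow.mk (g i))) :
    Realizes A f ((ELV.word x).subst w) ((ELV.word y).subst w') (arr A x y g) := by
  choose k a b l hw hw' e using h
  let L : Fin (∑ i, k i) → S := fun s =>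
    l ((blockEquiv k rfl).symm s).1 ((blockEquiv k rfl).symm s).2
  have hL (i : Fin n) (j : Fin (k i)) : L (blockEquiv k rfl ⟨i, j⟩) = l i j := by
    exact congrArg (fun t : Σ i, Fin (k i) => l t.1 t.2) ((blockEquiv k rfl).symm_apply_apply _)
  have key (x : ELV.obj n) (a : ∀ i, ELV.obj (k i)) (w : Fin n → Word S)
      (hw : ∀ i, (ELV.word (a i)).rename (l i) = w i) :
      (ELV.word ((ELV.comp k rfl).obj (x, a))).rename L = (ELV.word x).subst w := by
    rw [ELV.word_comp, Word.rename, Word.subst_subst]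
    congr 1
    funext i
    rw [← hw i]
    exact (Word.rename_rename _ _ _).trans
      (congrArg (fun l => Word.rename l _) (funext fun j => hL i j))
  refine ⟨_, (ELV.comp k rfl).obj (x, a), (ELV.comp k rfl).obj (y, b), L, key x a w hw,
    key y b w' hw', (arr_comp A k rfl x y a b _ g fun i => (e i).trans ?_).symm⟩
  exact arr_congr A _ _ fun j => by rw [hL i j]

/-- The two realizing morphisms need not share their middle object. Both middle objects give the
same word, hence differ by a permutation, and equivariance moves the second morphism so that they
can be composed. -/
theorem Realizes.comp {c c' : S → C} {f : c ⟶ c'} {w w' w'' : Word S} {X Y Z : C} {u : X ⟶ Y}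
    {v : Y ⟶ Z} (hu : Realizes A f w w' (Arrow.mk u)) (hv : Realizes A (𝟙 c') w' w'' (Arrow.mk v)) :
    Realizes A f w w'' (Arrow.mk (u ≫ v)) := by
  obtain ⟨n, x, y, l, rfl, rfl, e⟩ := hu
  obtain ⟨n', y', z, l', h, rfl, e'⟩ := hv
  obtain rfl := ELV.eq_of_rename_eq h
  obtain ⟨σ, rfl, rfl⟩ := ELV.exists_act_of_rename_eq h.symm
  obtain ⟨z, rfl⟩ := ELV.exists_act_eq σ z
  refine ⟨_, x, z, l, rfl, ?_, arr_comp_id A e (e'.trans ((arr_act A σ y z _).trans ?_))⟩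
  · rw [ELV.word_act, Word.rename_rename]
    simp
  · exact arr_congr A y z fun i => arrow_id (congrArg (fun i => c' (l i)) (σ.apply_symm_apply i))

/-- With distinct letters the realizing morphism is determined up to a single permutation, which
equivariance absorbs. With repeated letters the two ends could be matched by different permutations.
-/
theorem Realizes.eq_arr {n : ℕ} {c c' : Fin n → C} {f : c ⟶ c'} {x y : ELV.obj n} {a : Arrow C}
    (h : Realizes A f (ELV.word x) (ELV.word y) a) : a = arr A x y f := by
  obtain ⟨n', x', y', l, hx, hy, rfl⟩ := h
  rw [← Word.rename_id (ELV.word x)] at hx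
  rw [← Word.rename_id (ELV.word y)] at hy
  obtain rfl := ELV.eq_of_rename_eq hx
  obtain ⟨σ, rfl, h⟩ := ELV.exists_act_of_rename_eq hx
  obtain ⟨σ', rfl, h'⟩ := ELV.exists_act_of_rename_eq hy
  have hl : l = ⇑(σ⁻¹) := funext fun i => by simpa using (congrFun h (σ⁻¹ i)).symm
  have hl' : l = ⇑(σ'⁻¹) := funext fun i => by simpa using (congrFun h' (σ'⁻¹ i)).symm
  obtain rfl : σ = σ' := inv_injective (Equiv.ext (congrFun (hl.symm.trans hl')))
  subst hl
  exact (arr_act A σ x' y' f).symm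

variable (A)

theorem realizes_wordMap {c c' : S → C} (f : c ⟶ c') (w : Word S) :
    Realizes A f w w (Arrow.mk (wordMap (tensor A) f w)) := by
  induction w with
  | of s => exact .of f s
  | mul w₁ w₂ h₁ h₂ =>
    exact Realizes.act (w := ![w₁, w₂]) (w' := ![w₁, w₂]) ELV.mul ELV.mul
      ((pairFunctor C).map (Prod.mkHom (wordMap (tensor A) f w₁) (wordMap (tensor A) f w₂)))
      (Fin.forall_fin_two.2 ⟨h₁, h₂⟩)

theorem arrow_wordMap {n : ℕ} (x : ELV.obj n) {c c' : Fin n → C} (f : c ⟶ c') :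
    Arrow.mk (wordMap (tensor A) f (ELV.word x)) = arr A x x f :=
  (realizes_wordMap A f (ELV.word x)).eq_arr

theorem wordObj_eq {n : ℕ} (x : ELV.obj n) (c : Fin n → C) :
    wordObj (tensor A) c (ELV.word x) = (A.act n).obj (x, c) :=
  arrow_source (arrow_wordMap A x (𝟙 c))

/-- The action of `ELV` on morphisms, as a morphism between values of words. -/
def coherence {n : ℕ} (x y : ELV.obj n) (c : Fin n → C) :
    wordObj (tensor A) c (ELV.word x) ⟶ wordObj (tensor A) c (ELV.word y) :=
  eqToHom (wordObj_eq A x c) ≫ (A.act n).map (Prod.mkHom (ELV.hom x y) (𝟙 c)) ≫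
    eqToHom (wordObj_eq A y c).symm

theorem arrow_coherence {n : ℕ} (x y : ELV.obj n) (c : Fin n → C) :
    Arrow.mk (coherence A x y c) = arr A x y (𝟙 c) :=
  (arrow_eqToHom_comp (wordObj_eq A x c) _).trans
    (arrow_comp_eqToHom _ (wordObj_eq A y c).symm)

theorem coherence_comp {n : ℕ} (x y : ELV.obj n) (c : Fin n → C) :
    coherence A x y c ≫ coherence A y x c = 𝟙 _ := by
  refine arrow_injective ((arr_comp_id A (arrow_coherence A x y c)
    (arrow_coherence A y x c)).trans ?_)
  exact (congrArg Arrow.mk ((A.act n).map_id (x, c))).trans (arrow_id (wordObj_eq A x c).symm)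

/-- The action of `ELV` on morphisms, as an isomorphism between values of words. -/
def iso {n : ℕ} (x y : ELV.obj n) (c : Fin n → C) :
    wordObj (tensor A) c (ELV.word x) ≅ wordObj (tensor A) c (ELV.word y) :=
  ⟨coherence A x y c, coherence A y x c, coherence_comp A x y c, coherence_comp A y x c⟩

/-- The product, the associativity and the commutativity isomorphisms given by `A`. -/
def productData : ProductData C where
  tensor := tensor A
  -- The words of these objects evaluate to the required products by definition; that of
  -- `ELV.mulSwap`, below, has its letters reversed.
  associator a b c := iso A ELV.mulLeft ELV.mulRight ![a, b, c]
  braiding a b := iso A ELV.mul ELV.mulSwap ![a, b]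

/-- Each associator or braiding at values of words is an action on identities of these values, hence
realized; closure under composition and products does the rest. -/
theorem realizes_evFormal (c : S → C) {w w' : Word S} (p : Word.Formal w w') :
    Realizes A (𝟙 c) w w' (Arrow.mk ((productData A).evFormal c p)) := by
  have hid (w : Word S) : Realizes A (𝟙 c) w w (Arrow.mk (𝟙 (wordObj (tensor A) c w))) := by
    have := realizes_wordMap A (𝟙 c) w
    rwa [show wordMap (tensor A) (𝟙 c) w = _ from (productData A).evMap_id c w] at this
  have h₃ (w₁ w₂ w₃ : Word S) (x y : ELV.obj 3) :
      Realizes A (𝟙 c) ((ELV.word x).subst ![w₁, w₂, w₃]) ((ELV.word y).subst ![w₁, w₂, w₃])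
        (arr A x y (𝟙 ![wordObj (tensor A) c w₁, wordObj (tensor A) c w₂,
          wordObj (tensor A) c w₃])) :=
    Realizes.act x y _ fun i => match i with
      | 0 => hid w₁
      | 1 => hid w₂
      | 2 => hid w₃
  induction p with
  | id w => exact hid w
  | comp p q hp hq => exact hp.comp hq
  | mul p q hp hq =>
    exact Realizes.act (w := ![_, _]) (w' := ![_, _]) ELV.mul ELV.mul
      ((pairFunctor C).map (Prod.mkHom ((productData A).evFormal c p)
        ((productData A).evFormal c q))) (Fin.forall_fin_two.2 ⟨hp, hq⟩)
  | assoc w₁ w₂ w₃ =>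
    have := h₃ w₁ w₂ w₃ ELV.mulLeft ELV.mulRight
    rw [← arrow_coherence] at this
    exact this
  | assocInv w₁ w₂ w₃ =>
    have := h₃ w₁ w₂ w₃ ELV.mulRight ELV.mulLeft
    rw [← arrow_coherence] at this
    exact this
  | braid w₁ w₂ =>
    have := Realizes.act (A := A) (f := 𝟙 c) ELV.mul ELV.mulSwap
      (w := ![w₁, w₂]) (w' := ![w₁, w₂])
      (𝟙 ![wordObj (tensor A) c w₁, wordObj (tensor A) c w₂])
      (Fin.forall_fin_two.2 ⟨hid w₁, hid w₂⟩)
    rw [← arrow_coherence] at this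
    exact this

theorem arrow_evFormal {n : ℕ} {x y : ELV.obj n} (c : Fin n → C)
    (p : Word.Formal (ELV.word x) (ELV.word y)) :
    Arrow.mk ((productData A).evFormal c p) = arr A x y (𝟙 c) :=
  (realizes_evFormal A c p).eq_arr

end ELVAlgebra

/-! ### The axioms, and recovery of the algebra -/

namespace ELVAlgebra

variable {C : Type u} [Category.{v} C] (A : ELV.Algebra C)

/-- Coherence is free here: both values are the image of the same morphism of `ELV (n)`. -/
theorem evFormal_eq {n : ℕ} {x y : ELV.obj n} (c : Fin n → C) {w w' : Word (Fin n)}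
    (hx : ELV.word x = w) (hy : ELV.word y = w') (p q : Word.Formal w w') :
    (productData A).evFormal c p = (productData A).evFormal c q := by
  subst hx hy
  exact arrow_injective ((arrow_evFormal A c p).trans (arrow_evFormal A c q).symm)

theorem coherence_naturality {n : ℕ} (x y : ELV.obj n) {c c' : Fin n → C} (f : c ⟶ c') :
    wordMap (tensor A) f (ELV.word x) ≫ coherence A x y c' =
      coherence A x y c ≫ wordMap (tensor A) f (ELV.word y) :=
  arrow_injective ((arr_comp_id A (arrow_wordMap A x f) (arrow_coherence A x y c')).trans
    (arr_id_comp A (arrow_coherence A x y c) (arrow_wordMap A y f)).symm)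

open Paren Word in
/-- The non-unital symmetric monoidal structure of an `ELV`-algebra. -/
def toNonunitalSymmetricMonoidal : NonunitalSymmetricMonoidal C where
  tensor := tensor A
  associator := (productData A).associator
  braiding := (productData A).braiding
  associator_naturality {a a' b b' c c'} f g h :=
    coherence_naturality A ELV.mulLeft ELV.mulRight (c := ![a, b, c]) (c' := ![a', b', c'])
      fun i => match i with
        | 0 => f
        | 1 => g
        | 2 => h
  braiding_naturality {a a' b b'} f g :=
    coherence_naturality A ELV.mul ELV.mulSwap (c := ![a, b]) (c' := ![a', b'])
      fun i => match i with
        | 0 => f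
        | 1 => g
  symmetry a b := evFormal_eq A (x := ELV.mul) (y := ELV.mul) ![a, b] rfl rfl
    (.comp (.braid (of 0) (of 1)) (.braid (of 1) (of 0))) (.id _)
  pentagon a b c d := by
    have := evFormal_eq A (x := ELV.mk 4 (pair (pair (pair one one) one) one) rfl 1)
      (y := ELV.mk 4 (pair one (pair one (pair one one))) rfl 1) ![a, b, c, d] rfl rfl
      (.comp (.mul (.assoc (of 0) (of 1) (of 2)) (.id (of 3)))
        (.comp (.assoc (of 0) (.mul (of 1) (of 2)) (of 3))
          (.mul (.id (of 0)) (.assoc (of 1) (of 2) (of 3)))))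
      (.comp (.assoc (.mul (of 0) (of 1)) (of 2) (of 3))
        (.assoc (of 0) (of 1) (.mul (of 2) (of 3))))
    exact this
  hexagon a b c := by
    have := evFormal_eq A (x := ELV.mulLeft)
      -- The inverse rotation is chosen so that the letters of the word read 1, 2, 0.
      (y := ELV.mk 3 (pair one (pair one one)) rfl (finRotate 3)⁻¹) ![a, b, c] rfl rfl
      (.comp (.assoc (of 0) (of 1) (of 2))
        (.comp (.braid (of 0) (.mul (of 1) (of 2))) (.assoc (of 1) (of 2) (of 0))))
      (.comp (.mul (.braid (of 0) (of 1)) (.id (of 2)))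
        (.comp (.assoc (of 1) (of 0) (of 2)) (.mul (.id (of 1)) (.braid (of 0) (of 2)))))
    exact this

theorem isInducedBy : IsInducedBy (toNonunitalSymmetricMonoidal A) A where
  tensor_eq := rfl
  associator_eq a b c := arrow_coherence A ELV.mulLeft ELV.mulRight ![a, b, c]
  braiding_eq a b := arrow_coherence A ELV.mul ELV.mulSwap ![a, b]

/-- Any morphism of `ELV (n) × C ^ n` factors into a part over an identity of `ELV` and one over an
identity list; both are values of words or formal composites. -/
theorem toAlgebra_toNonunitalSymmetricMonoidal :
    (toNonunitalSymmetricMonoidal A).toAlgebra = A := by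
  have h : (toNonunitalSymmetricMonoidal A).toAlgebra.act = A.act := funext fun n =>
    functor_eq_of_arrow fun {p q} φ =>
      arr_comp_id A (arrow_wordMap A p.1 φ.2) (arrow_evFormal A q.2 (ELV.formal p.1 q.1))
  generalize (toNonunitalSymmetricMonoidal A).toAlgebra = B at h
  cases A
  cases B
  cases h
  rfl

end ELVAlgebra

/-! ### The bijection and strict maps -/

section Bijection

variable {C : Type u} [Category.{v} C] {D : Type u} [Category.{v} D]

theorem IsInducedBy.unique {M N : NonunitalSymmetricMonoidal C} {A : ELV.Algebra C}
    (hM : IsInducedBy M A) (hN : IsInducedBy N A) : M = N := by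
  have h := hM.tensor_eq.trans hN.tensor_eq.symm
  have h₁ a b c := (hM.associator_eq a b c).trans (hN.associator_eq a b c).symm
  have h₂ a b := (hM.braiding_eq a b).trans (hN.braiding_eq a b).symm
  clear hM hN
  cases M
  cases N
  cases h
  congr 1
  · funext a b c
    exact Iso.ext (arrow_injective (h₁ a b c))
  · funext a b
    exact Iso.ext (arrow_injective (h₂ a b))

/-- Coherence replaces the chosen formal composites by the identity, the associator and the braiding
themselves. -/
theorem NonunitalSymmetricMonoidal.isInducedBy_toAlgebra (M : NonunitalSymmetricMonoidal C) :
    IsInducedBy M M.toAlgebra where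
  tensor_eq := functor_eq_of_arrow fun {X Y} f => by
    change _ = Arrow.mk (M.tensor.map f ≫ M.toProductData.evFormal ((pairFunctor C).obj Y)
      (ELV.formal ELV.mul ELV.mul))
    rw [M.evFormal_eq _ (ELV.formal ELV.mul ELV.mul) (.id _) (ELV.nodup_letters_word _)]
    exact congrArg Arrow.mk (Category.comp_id _).symm
  associator_eq a b c := by
    change _ = Arrow.mk (M.toProductData.evMap (𝟙 ![a, b, c]) _ ≫
      M.toProductData.evFormal ![a, b, c] (ELV.formal ELV.mulLeft ELV.mulRight))
    rw [M.evFormal_eq _ (ELV.formal ELV.mulLeft ELV.mulRight) (.assoc (.of 0) (.of 1) (.of 2))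
      (ELV.nodup_letters_word _), ProductData.evMap_id]
    exact congrArg Arrow.mk (Category.id_comp _).symm
  braiding_eq a b := by
    change _ = Arrow.mk (M.toProductData.evMap (𝟙 ![a, b]) _ ≫
      M.toProductData.evFormal ![a, b] (ELV.formal ELV.mul ELV.mulSwap))
    rw [M.evFormal_eq _ (ELV.formal ELV.mul ELV.mulSwap) (.braid (.of 0) (.of 1))
      (ELV.nodup_letters_word _), ProductData.evMap_id]
    exact congrArg Arrow.mk (Category.id_comp _).symm

/-- `ELV`-algebra structures on `C` are the same as non-unital symmetric monoidal structures. -/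
noncomputable def algebraEquiv (C : Type u) [Category.{v} C] :
    ELV.Algebra C ≃ NonunitalSymmetricMonoidal C where
  toFun := ELVAlgebra.toNonunitalSymmetricMonoidal
  invFun := NonunitalSymmetricMonoidal.toAlgebra
  left_inv := ELVAlgebra.toAlgebra_toNonunitalSymmetricMonoidal
  -- Both `M` and the structure built from its algebra are induced by that algebra.
  right_inv M := (ELVAlgebra.isInducedBy M.toAlgebra).unique M.isInducedBy_toAlgebra

/-- A strict functor commutes with evaluation, and both algebras use the same chosen formal
composites. -/
theorem NonunitalSymmetricMonoidal.IsStrictMap.isMap {M : NonunitalSymmetricMonoidal C}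
    {N : NonunitalSymmetricMonoidal D} {F : C ⥤ D} (h : M.IsStrictMap N F) :
    M.toAlgebra.IsMap N.toAlgebra F := fun n => functor_eq_of_arrow fun {p q} φ => by
  have hF : M.toProductData.IsStrict N.toProductData F :=
    ⟨h.map_tensor, h.map_associator, h.map_braiding⟩
  exact (congrArg Arrow.mk (F.map_comp _ _)).trans
    (arrow_comp (hF.evMap φ.2 _) (hF.evFormal q.2 _))

theorem IsInducedBy.isStrictMap {M : NonunitalSymmetricMonoidal C}
    {N : NonunitalSymmetricMonoidal D} {A : ELV.Algebra C} {B : ELV.Algebra D}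
    (hM : IsInducedBy M A) (hN : IsInducedBy N B) {F : C ⥤ D} (h : A.IsMap B F) :
    M.IsStrictMap N F where
  map_tensor := by
    rw [hM.tensor_eq, hN.tensor_eq]
    refine functor_eq_of_arrow fun {X Y} f => (arrow_of_functor_eq (h 2) _).trans ?_
    exact ELVAlgebra.arr_congr B ELV.mul ELV.mul (Fin.forall_fin_two.2 ⟨rfl, rfl⟩)
  map_associator a b c := by
    refine (arrow_map F (hM.associator_eq a b c)).trans ?_
    refine Eq.trans ?_ (hN.associator_eq _ _ _).symm
    refine (arrow_of_functor_eq (h 3) _).trans ?_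
    exact ELVAlgebra.arr_congr B ELV.mulLeft ELV.mulRight fun i => match i with
      | 0 => congrArg Arrow.mk (F.map_id a)
      | 1 => congrArg Arrow.mk (F.map_id b)
      | 2 => congrArg Arrow.mk (F.map_id c)
  map_braiding a b := by
    refine (arrow_map F (hM.braiding_eq a b)).trans ?_
    refine Eq.trans ?_ (hN.braiding_eq _ _).symm
    refine (arrow_of_functor_eq (h 2) _).trans ?_
    exact ELVAlgebra.arr_congr B ELV.mul ELV.mulSwap fun i => match i with
      | 0 => congrArg Arrow.mk (F.map_id a)
      | 1 => congrArg Arrow.mk (F.map_id b)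

theorem isMap_iff_isStrictMap (A : ELV.Algebra C) (B : ELV.Algebra D) (F : C ⥤ D) :
    A.IsMap B F ↔ (algebraEquiv C A).IsStrictMap (algebraEquiv D B) F := by
  refine ⟨(ELVAlgebra.isInducedBy A).isStrictMap (ELVAlgebra.isInducedBy B), fun h => ?_⟩
  have := h.isMap
  rwa [← (algebraEquiv C).symm_apply_apply A, ← (algebraEquiv D).symm_apply_apply B]

end Bijection

/-! ### The isomorphism of categories -/

section Isomorphism

/-- The non-unital symmetric monoidal category of an `ELV`-algebra. -/
noncomputable def algebraToMonoidal :
    CatOperad.AlgebraCat.{v, u} ELV ⥤ NonunitalSymMonCat.{v, u} where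
  obj X := ⟨X.carrier, algebraEquiv X.carrier X.str⟩
  map F := ⟨F.functor, (isMap_iff_isStrictMap _ _ _).1 F.isMap⟩

/-- The `ELV`-algebra of a non-unital symmetric monoidal category. -/
noncomputable def monoidalToAlgebra :
    NonunitalSymMonCat.{v, u} ⥤ CatOperad.AlgebraCat.{v, u} ELV where
  obj X := ⟨X.carrier, (algebraEquiv X.carrier).symm X.str⟩
  map F := ⟨F.functor, (isMap_iff_isStrictMap _ _ _).2 (by
    rw [Equiv.apply_symm_apply, Equiv.apply_symm_apply]
    exact F.isStrictMap)⟩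

/-- Replacing the structures at both ends by equal ones leaves an arrow unchanged when the
underlying functor is the same. This handles a round trip that restores structures only up to
provable equality. -/
theorem CatOperad.AlgebraCat.arrow_hom {C D : Type u} [Category.{v} C] [Category.{v} D]
    {A A' : ELV.Algebra C} {B B' : ELV.Algebra D} (hA : A = A') (hB : B = B') (F : C ⥤ D)
    (h : A.IsMap B F) (h' : A'.IsMap B' F) :
    Arrow.mk (X := (⟨C, A⟩ : CatOperad.AlgebraCat ELV)) (Y := ⟨D, B⟩)
        (CatOperad.AlgebraCat.Hom.mk F h) =
      Arrow.mk (X := (⟨C, A'⟩ : CatOperad.AlgebraCat ELV)) (Y := ⟨D, B'⟩)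
        (CatOperad.AlgebraCat.Hom.mk F h') := by
  subst hA hB
  rfl

theorem NonunitalSymMonCat.arrow_hom {C D : Type u} [Category.{v} C] [Category.{v} D]
    {M M' : NonunitalSymmetricMonoidal C} {N N' : NonunitalSymmetricMonoidal D} (hM : M = M')
    (hN : N = N') (F : C ⥤ D) (h : M.IsStrictMap N F) (h' : M'.IsStrictMap N' F) :
    Arrow.mk (X := (⟨C, M⟩ : NonunitalSymMonCat)) (Y := ⟨D, N⟩)
        (NonunitalSymMonCat.Hom.mk F h) =
      Arrow.mk (X := (⟨C, M'⟩ : NonunitalSymMonCat)) (Y := ⟨D, N'⟩)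
        (NonunitalSymMonCat.Hom.mk F h') := by
  subst hM hN
  rfl

theorem algebraToMonoidal_comp_monoidalToAlgebra :
    algebraToMonoidal.{v, u} ⋙ monoidalToAlgebra = 𝟭 _ :=
  functor_eq_of_arrow fun {X Y} F => CatOperad.AlgebraCat.arrow_hom
    ((algebraEquiv X.carrier).symm_apply_apply X.str)
    ((algebraEquiv Y.carrier).symm_apply_apply Y.str) F.functor _ F.isMap

theorem monoidalToAlgebra_comp_algebraToMonoidal :
    monoidalToAlgebra.{v, u} ⋙ algebraToMonoidal = 𝟭 _ :=
  functor_eq_of_arrow fun {X Y} F => NonunitalSymMonCat.arrow_hom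
    ((algebraEquiv X.carrier).apply_symm_apply X.str)
    ((algebraEquiv Y.carrier).apply_symm_apply Y.str) F.functor _ F.isStrictMap

end Isomorphism

end SymMonOperads

theorem mainTheorem4 :
    ∃ Φ : ∀ (C : Type u) [Category.{v} C],
        SymMonOperads.ELV.Algebra C ≃ SymMonOperads.NonunitalSymmetricMonoidal C,
      (∀ (C : Type u) [Category.{v} C] (A : SymMonOperads.ELV.Algebra C),
        SymMonOperads.IsInducedBy (Φ C A) A) ∧
      (∀ (C D : Type u) [Category.{v} C] [Category.{v} D] (A : SymMonOperads.ELV.Algebra C)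
        (B : SymMonOperads.ELV.Algebra D) (F : C ⥤ D),
        A.IsMap B F ↔ (Φ C A).IsStrictMap (Φ D B) F) ∧
      ∃ (P : SymMonOperads.CatOperad.AlgebraCat.{v, u} SymMonOperads.ELV ⥤
            SymMonOperads.NonunitalSymMonCat.{v, u})
        (Q : SymMonOperads.NonunitalSymMonCat.{v, u} ⥤
            SymMonOperads.CatOperad.AlgebraCat.{v, u} SymMonOperads.ELV),
        P ⋙ Q = 𝟭 _ ∧ Q ⋙ P = 𝟭 _ ∧
        (∀ X : SymMonOperads.CatOperad.AlgebraCat.{v, u} SymMonOperads.ELV,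
          P.obj X = ⟨X.carrier, Φ X.carrier X.str⟩) ∧
        P ⋙ SymMonOperads.NonunitalSymMonCat.forget =
          SymMonOperads.CatOperad.AlgebraCat.forget SymMonOperads.ELV :=
  ⟨fun C => SymMonOperads.algebraEquiv C,
    fun _ _ A => SymMonOperads.ELVAlgebra.isInducedBy A,
    fun _ _ _ _ A B F => SymMonOperads.isMap_iff_isStrictMap A B F,
    SymMonOperads.algebraToMonoidal, SymMonOperads.monoidalToAlgebra,
    SymMonOperads.algebraToMonoidal_comp_monoidalToAlgebra,
    SymMonOperads.monoidalToAlgebra_comp_algebraToMonoidal, fun _ => rfl, rfl⟩
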